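/- Let $K$ be a field, $Q$ a quiver with finitely many vertices, $KQ$ its path algebra (paths are composed from left to right), and $\mathcal B$ the set of all finite directed paths of $Q$, including one path of length zero for each vertex. Let $\succ$ be an admissible order on $\mathcal B$: a well-order such that $p\succ q$ implies $sp\succ sq$ whenever $sp,sq\neq 0$ and $ps\succ qs$ whenever $ps,qs\neq 0$, and such that $p=sqt$ implies $p\succeq q$, for all $p,q,s,t\in\mathcal B$. Let $I$ be an admissible ideal of $KQ$, i.e. a two-sided ideal with $A^m\subseteq I\subseteq A^2$ for some $m\ge 2$, where $A$ is the ideal generated by the arrows, and suppose that $\Lambda=KQ/I$ is finite dimensional over $K$. For $0\ne x\in KQ$ let $\operatorname{tip}(x)$ be the $\succ$-largest path that occurs in $x$ with non-zero coefficient, and let $\Lambda_{Mon}=KQ/\langle \operatorname{tip}(x) : 0\neq x\in I\rangle$ be the associated monomial algebra. A two-sided ideal $L$ of a ring $R$ with Jacobson radical $J(R)$ is called heredity if $L^2=L$, $L\,J(R)\,L=0$, and $L$ is projective as a left or as a right $R$-module. A chain $0=L_0\subseteq L_1\subseteq\dots\subseteq L_n=R$ of two-sided ideals is a heredity chain if $L_{i}/L_{i-1}$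 is a heredity ideal of $R/L_{i-1}$ for all $1\le i\le n$, and $R$ is quasi-hereditary if it has a heredity chain. If $\Lambda_{Mon}$ is quasi-hereditary, then $\Lambda$ is quasi-hereditary. More precisely, suppose that $\Lambda_{Mon}$ is quasi-hereditary. Then $\Lambda$ is quasi-hereditary; there is an ordering $v_1,\dots,v_n$ of all the vertices of $Q$ such that, with $e_i=v_1+\dots+v_i$ and $e_0=0$, the ideals $\Lambda_{Mon}e_i\Lambda_{Mon}$ $(0\le i\le n)$ form a heredity chain of $\Lambda_{Mon}$; and for every such ordering the ideals $\Lambda e_i\Lambda$ $(0\le i\le n)$ form a heredity chain of $\Lambda$. -/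

import Mathlib

universe u v w

noncomputable section

/-! ### Path algebras -/

/-- The finite directed paths of a quiver, the vertices being the paths of length zero. -/
abbrev QuiverPath (V : Type v) [Quiver.{w} V] : Type (max v w) :=
  Σ a b : V, Quiver.Path a b

/-- The underlying vector space of the path algebra `KQ`: the `K`-vector space with basis the set
of all paths. -/
def PathAlgebra (K : Type u) (V : Type v) [Quiver.{w} V] [Field K] : Type (max u v w) :=
  QuiverPath V →₀ K

namespace PathAlgebra

section Basic

variable {K : Type u} {V : Type v} [Quiver.{w} V] [Field K]

instance : AddCommGroup (PathAlgebra K V) := inferInstanceAs (AddCommGroup (QuiverPath V →₀ K))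

instance : Module K (PathAlgebra K V) := inferInstanceAs (Module K (QuiverPath V →₀ K))

variable (K) in
/-- A path, as an element of the path algebra. -/
def ofPath (p : QuiverPath V) : PathAlgebra K V := Finsupp.single p 1

/-- The coefficient of a path in an element of the path algebra. -/
def coeff (x : PathAlgebra K V) (p : QuiverPath V) : K := (show QuiverPath V →₀ K from x) p

variable (K) in
/-- The vertex `v`, as an element of the path algebra. -/
def vertex (v : V) : PathAlgebra K V := ofPath K ⟨v, v, Quiver.Path.nil⟩

open Classical in
variable (K) in
/-- The product of two paths: first `p`, then `q`, if `p` ends where `q` starts, and `0` if not. -/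
def pathMul (p q : QuiverPath V) : PathAlgebra K V :=
  if h : p.2.1 = q.1 then ofPath K ⟨p.1, q.2.1, p.2.2.comp (q.2.2.cast h.symm rfl)⟩ else 0

variable (K V) in
/-- The bilinear extension of the product of paths. -/
def mulHom : PathAlgebra K V →ₗ[K] PathAlgebra K V →ₗ[K] PathAlgebra K V :=
  Finsupp.linearCombination K fun p : QuiverPath V =>
    (Finsupp.linearCombination K fun q : QuiverPath V => pathMul K p q :
      (QuiverPath V →₀ K) →ₗ[K] PathAlgebra K V)

instance : Mul (PathAlgebra K V) := ⟨fun x y => mulHom K V x y⟩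

theorem mul_def (x y : PathAlgebra K V) : x * y = mulHom K V x y := rfl

theorem induction_on {P : PathAlgebra K V → Prop} (x : PathAlgebra K V) (zero : P 0)
    (add : ∀ x y, P x → P y → P (x + y)) (smul : ∀ (c : K) p, P (c • ofPath K p)) : P x := by
  refine Finsupp.induction_linear (motive := P) x zero add fun p c => ?_
  have h : (Finsupp.single p c : QuiverPath V →₀ K) = c • ofPath K p := by
    rw [ofPath]
    erw [Finsupp.smul_single, smul_eq_mul, mul_one]
  rw [h]
  exact smul c p

protected theorem add_mul (x y z : PathAlgebra K V) : (x + y) * z = x * z + y * z := by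
  simp only [mul_def, map_add, LinearMap.add_apply]

protected theorem mul_add (x y z : PathAlgebra K V) : x * (y + z) = x * y + x * z := by
  simp only [mul_def, map_add]

protected theorem zero_mul (x : PathAlgebra K V) : 0 * x = 0 := by
  simp only [mul_def, map_zero, LinearMap.zero_apply]

protected theorem mul_zero (x : PathAlgebra K V) : x * 0 = 0 := by
  simp only [mul_def, map_zero]

protected theorem smul_mul (c : K) (x y : PathAlgebra K V) : (c • x) * y = c • (x * y) := by
  simp only [mul_def, map_smul, LinearMap.smul_apply]

protected theorem mul_smul (c : K) (x y : PathAlgebra K V) : x * (c • y) = c • (x * y) := by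
  simp only [mul_def, map_smul]

theorem ofPath_mul_ofPath (p q : QuiverPath V) : ofPath K p * ofPath K q = pathMul K p q := by
  rw [mul_def, mulHom, ofPath, ofPath]
  erw [Finsupp.linearCombination_single, one_smul, Finsupp.linearCombination_single, one_smul]

theorem ofPath_mul_comp {a b c : V} (p : Quiver.Path a b) (q : Quiver.Path b c) :
    ofPath K ⟨a, b, p⟩ * ofPath K ⟨b, c, q⟩ = ofPath K ⟨a, c, p.comp q⟩ := by
  rw [ofPath_mul_ofPath, pathMul, dif_pos rfl]
  rfl

theorem ofPath_mul_of_ne {a b c d : V} (p : Quiver.Path a b) (q : Quiver.Path c d) (h : b ≠ c) :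
    ofPath K ⟨a, b, p⟩ * ofPath K ⟨c, d, q⟩ = 0 := by
  rw [ofPath_mul_ofPath, pathMul, dif_neg h]

theorem mul_assoc_ofPath (p q r : QuiverPath V) :
    ofPath K p * ofPath K q * ofPath K r = ofPath K p * (ofPath K q * ofPath K r) := by
  obtain ⟨a, b, p⟩ := p
  obtain ⟨c, d, q⟩ := q
  obtain ⟨e, f, r⟩ := r
  by_cases h : b = c
  · subst h
    by_cases h' : d = e
    · subst h'
      simp only [ofPath_mul_comp, Quiver.Path.comp_assoc]
    · rw [ofPath_mul_comp, ofPath_mul_of_ne _ _ h', ofPath_mul_of_ne _ _ h', mul_def, map_zero]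
  · rw [ofPath_mul_of_ne _ _ h]
    by_cases h' : d = e
    · subst h'
      rw [ofPath_mul_comp, ofPath_mul_of_ne _ _ h, mul_def, map_zero, LinearMap.zero_apply]
    · rw [ofPath_mul_of_ne _ _ h', mul_def, mul_def, map_zero, map_zero, LinearMap.zero_apply]

protected theorem mul_assoc (x y z : PathAlgebra K V) : x * y * z = x * (y * z) := by
  induction x using induction_on with
  | zero => simp only [PathAlgebra.zero_mul]
  | add x x' hx hx' => simp only [PathAlgebra.add_mul, hx, hx']
  | smul a p =>
    induction y using induction_on with
    | zero => simp only [PathAlgebra.zero_mul, PathAlgebra.mul_zero]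
    | add y y' hy hy' => simp only [PathAlgebra.add_mul, PathAlgebra.mul_add, hy, hy']
    | smul b q =>
      induction z using induction_on with
      | zero => simp only [PathAlgebra.mul_zero]
      | add z z' hz hz' => simp only [PathAlgebra.mul_add, hz, hz']
      | smul c r =>
        simp only [PathAlgebra.smul_mul, PathAlgebra.mul_smul, mul_assoc_ofPath]

end Basic

section Ring

variable {K : Type u} {V : Type v} [Quiver.{w} V] [Field K] [Fintype V]

/-- The unit of the path algebra is the sum of all vertices. -/
instance : One (PathAlgebra K V) := ⟨∑ v : V, vertex K v⟩

theorem one_def : (1 : PathAlgebra K V) = ∑ v : V, vertex K v := rfl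

theorem one_mul_ofPath (p : QuiverPath V) : 1 * ofPath K p = ofPath K p := by
  obtain ⟨a, b, p⟩ := p
  rw [one_def, mul_def, map_sum, LinearMap.sum_apply, Finset.sum_eq_single a]
  · rw [← mul_def, vertex, ofPath_mul_comp, Quiver.Path.nil_comp]
  · intro v _ hv
    rw [← mul_def, vertex, ofPath_mul_of_ne _ _ hv]
  · exact fun h => absurd (Finset.mem_univ a) h

theorem ofPath_mul_one (p : QuiverPath V) : ofPath K p * 1 = ofPath K p := by
  obtain ⟨a, b, p⟩ := p
  rw [one_def, mul_def, map_sum, Finset.sum_eq_single b]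
  · rw [← mul_def, vertex, ofPath_mul_comp, Quiver.Path.comp_nil]
  · intro v _ hv
    rw [← mul_def, vertex, ofPath_mul_of_ne _ _ hv.symm]
  · exact fun h => absurd (Finset.mem_univ b) h

protected theorem one_mul (x : PathAlgebra K V) : 1 * x = x := by
  induction x using induction_on with
  | zero => exact PathAlgebra.mul_zero 1
  | add x y hx hy => rw [PathAlgebra.mul_add, hx, hy]
  | smul c p => rw [PathAlgebra.mul_smul, one_mul_ofPath]

protected theorem mul_one (x : PathAlgebra K V) : x * 1 = x := by
  induction x using induction_on with
  | zero => exact PathAlgebra.zero_mul 1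
  | add x y hx hy => rw [PathAlgebra.add_mul, hx, hy]
  | smul c p => rw [PathAlgebra.smul_mul, ofPath_mul_one]

instance : Ring (PathAlgebra K V) :=
  { (inferInstance : AddCommGroup (PathAlgebra K V)),
    (inferInstance : Mul (PathAlgebra K V)),
    (inferInstance : One (PathAlgebra K V)) with
    left_distrib := PathAlgebra.mul_add
    right_distrib := PathAlgebra.add_mul
    zero_mul := PathAlgebra.zero_mul
    mul_zero := PathAlgebra.mul_zero
    mul_assoc := PathAlgebra.mul_assoc
    one_mul := PathAlgebra.one_mul
    mul_one := PathAlgebra.mul_one }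

instance : Algebra K (PathAlgebra K V) :=
  Algebra.ofModule PathAlgebra.smul_mul fun c x y => PathAlgebra.mul_smul c x y

end Ring

end PathAlgebra

/-! ### Admissible ideals, tips and the associated monomial algebra -/

section Groebner

variable {K : Type u} {V : Type v} [Quiver.{w} V] [Field K] [Fintype V]

variable (K V) in
/-- The two-sided ideal of the path algebra generated by the arrows. -/
def arrowIdeal : TwoSidedIdeal (PathAlgebra K V) :=
  TwoSidedIdeal.span {x | ∃ p : QuiverPath V, p.2.2.length = 1 ∧ x = PathAlgebra.ofPath K p}

/-- A two-sided ideal `I` of `KQ` is admissible if `A ^ m ⊆ I ⊆ A ^ 2` for some `m ≥ 2`, where `A`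
is the ideal generated by the arrows. -/
def IsAdmissibleIdeal (I : TwoSidedIdeal (PathAlgebra K V)) : Prop :=
  (∃ m : ℕ, 2 ≤ m ∧ (arrowIdeal K V).asIdeal ^ m ≤ I.asIdeal) ∧
    I.asIdeal ≤ (arrowIdeal K V).asIdeal ^ 2

/-- Admissible orders on the set of paths; `r p q` is read as `p ≺ q`. -/
structure IsAdmissibleOrder (r : QuiverPath V → QuiverPath V → Prop) : Prop where
  /-- `≺` is a strict total order in which every non-empty set of paths has a minimal element. -/
  isWellOrder : IsWellOrder (QuiverPath V) r
  /-- `≺` is preserved by left multiplication, if both products are non-zero. -/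
  comp_left : ∀ {a b c d : V} (s : Quiver.Path a b) (p : Quiver.Path b c) (q : Quiver.Path b d),
    r ⟨b, c, p⟩ ⟨b, d, q⟩ → r ⟨a, c, s.comp p⟩ ⟨a, d, s.comp q⟩
  /-- `≺` is preserved by right multiplication, if both products are non-zero. -/
  comp_right : ∀ {a b c d : V} (p : Quiver.Path a c) (q : Quiver.Path b c) (s : Quiver.Path c d),
    r ⟨a, c, p⟩ ⟨b, c, q⟩ → r ⟨a, d, p.comp s⟩ ⟨b, d, q.comp s⟩
  /-- A path is at least as large as each of its subpaths. -/
  subpath_le : ∀ {a b c d : V} (s : Quiver.Path a b) (q : Quiver.Path b c) (t : Quiver.Path c d),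
    (⟨b, c, q⟩ : QuiverPath V) = ⟨a, d, (s.comp q).comp t⟩ ∨
      r ⟨b, c, q⟩ ⟨a, d, (s.comp q).comp t⟩

/-- `p` is the tip of `x`: the largest path that occurs in `x`. Only a non-zero `x` has a tip. -/
def IsTip (r : QuiverPath V → QuiverPath V → Prop) (x : PathAlgebra K V) (p : QuiverPath V) :
    Prop :=
  x.coeff p ≠ 0 ∧ ∀ q, x.coeff q ≠ 0 → q = p ∨ r q p

/-- The ideal `⟨tip(I)⟩` generated by the tips of the non-zero elements of `I`. -/
def monomialIdeal (r : QuiverPath V → QuiverPath V → Prop) (I : TwoSidedIdeal (PathAlgebra K V)) :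
    TwoSidedIdeal (PathAlgebra K V) :=
  TwoSidedIdeal.span {y | ∃ x ∈ I, ∃ p, IsTip r x p ∧ y = PathAlgebra.ofPath K p}

/-- The algebra `KQ/I`. -/
abbrev QuiverAlgebra (I : TwoSidedIdeal (PathAlgebra K V)) : Type (max u v w) :=
  PathAlgebra K V ⧸ I.asIdeal

end Groebner

/-! ### Quasi-hereditary algebras -/

section QuasiHereditary

/-- A two-sided ideal `L` of `R` is heredity if `L² = L`, `L J(R) L = 0`, where `J(R)` is the
Jacobson radical of `R`, and `L` is projective as a left or right `R`-module. -/
structure IsHeredityIdeal {R : Type*} [Ring R] (L : TwoSidedIdeal R) : Prop where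
  mul_self : L.asIdeal * L.asIdeal = L.asIdeal
  mul_jacobson_mul : L.asIdeal * Ring.jacobson R * L.asIdeal = ⊥
  projective : Module.Projective R L ∨ Module.Projective Rᵐᵒᵖ L

/-- `0 = L 0 ⊆ L 1 ⊆ ⋯ ⊆ L n = R` is a heredity chain: each `L (i + 1) / L i` is a heredity ideal
of `R / L i`. The values of `L` beyond `n` play no role. -/
structure IsHeredityChain {R : Type*} [Ring R] (n : ℕ) (L : ℕ → TwoSidedIdeal R) : Prop where
  zero : L 0 = ⊥
  last : L n = ⊤
  le_succ : ∀ i < n, L i ≤ L (i + 1)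
  heredity : ∀ i < n,
    IsHeredityIdeal ((L (i + 1)).map (Ideal.Quotient.mk (L i).asIdeal))

/-- A ring is quasi-hereditary if it has a heredity chain. -/
def IsQuasiHereditary (R : Type*) [Ring R] : Prop :=
  ∃ (n : ℕ) (L : ℕ → TwoSidedIdeal R), IsHeredityChain n L

variable {K : Type u} {V : Type v} [Quiver.{w} V] [Field K] [Fintype V]

/-- For an ordering `v₁, …, vₙ` of the vertices, the ideals `Λ eᵢ Λ` of `Λ = KQ/I`, where
`eᵢ = v₁ + ⋯ + vᵢ` (so `e₀ = 0`). The vertex `vⱼ` is `σ (j - 1)`. -/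
def vertexChain (I : TwoSidedIdeal (PathAlgebra K V)) (σ : Fin (Fintype.card V) ≃ V) (i : ℕ) :
    TwoSidedIdeal (QuiverAlgebra I) :=
  TwoSidedIdeal.span {Ideal.Quotient.mk I.asIdeal
    (∑ j : Fin (Fintype.card V) with j.val < i, PathAlgebra.vertex K (σ j))}

end QuasiHereditary

end

/-!
The proof reduces both sides to one combinatorial condition on sets of paths. Call a path reducible
for a quotient `φ : KQ → R` if modulo `ker φ` it is a combination of smaller paths with the same end
points. The reducible paths are the tips of `ker φ`; they are the same for `Λ = KQ/I` and for
`Λ_Mon`, and in both algebras the irreducible paths form a basis (`exists_normalForm`,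
`eq_zero_of_mem_pathSpan_irreducible`). For a set `S` of paths and a set `W` of vertices the
condition `IsHereditySet S W` asks that every path of positive length between vertices of `W` lies
in `S`, and that two paths outside `S` meeting in a vertex of `W` have their composite outside `S`.

For any quotient in which long paths vanish, the condition for the reducible paths and a vertex `v`
implies that the ideal `RvR` is heredity: cycles at `v` are nilpotent multiples of `v`, hence zero,
and the composites `pq` of irreducible paths meeting in `v` are distinct irreducible paths, so that
`RvR` is the direct sum of the left ideals `Rvq ≅ Rv` (`isHeredityIdeal_vertexIdeal`). The same
independence shows that killing `v` enlarges the set of reducible paths exactly by the paths through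
`v` (`reduciblePaths_of_ker_vertexIdeal`). So whether the condition holds successively along an
ordering of the vertices depends on the reducible paths of the first quotient only, and if it does,
the ordering gives a heredity chain (`isHeredityChain_vertexChain`), for `Λ` as well as for `Λ_Mon`.

Conversely, in a monomial algebra where long paths vanish a heredity ideal `L` is generated by the
vertices `W` it contains (`eq_vertexIdeal_of_mul_self`), and `IsHereditySet S W` holds for the set
`S` of vanishing paths: `L J L = 0` kills the paths of positive length between vertices of `W`, and
a splitting of the obvious presentation of the projective module `L` shows that `pq = 0` forces `p =
0` or `q = 0` (`isHereditySet_of_isHeredityIdeal`). Applied along an arbitrary heredity chain this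
gives the condition for sets of vertices, which passes to the single vertices in any ordering that
is compatible with the chain (`IsHereditySet.singleton`).
-/

open PathAlgebra

/-! ### Paths and sets of paths -/

section Paths

variable {V : Type v} [Quiver.{w} V]

/-- If two factorizations of a path agree, the longer initial factor extends the shorter one. -/
theorem Quiver.Path.exists_comp_of_comp_eq {a b b' c : V} (p : Quiver.Path a b)
    (p' : Quiver.Path a b') (q : Quiver.Path b c) (q' : Quiver.Path b' c)
    (h : p.comp q = p'.comp q') (hl : p.length ≤ p'.length) :
    ∃ t : Quiver.Path b b', p' = p.comp t ∧ q = t.comp q' := by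
  induction q' with
  | nil => exact ⟨q, h.symm, rfl⟩
  | cons q₁ e ih =>
    cases q with
    | nil =>
      have := congrArg Quiver.Path.length h
      simp only [Quiver.Path.comp_nil, Quiver.Path.length_comp, Quiver.Path.length_cons] at this
      omega
    | cons q₂ e' =>
      simp only [Quiver.Path.comp_cons] at h
      obtain rfl := Quiver.Path.obj_eq_of_cons_eq_cons h
      have h1 := eq_of_heq (Quiver.Path.heq_of_cons_eq_cons h)
      have h2 := eq_of_heq (Quiver.Path.hom_heq_of_cons_eq_cons h)
      obtain ⟨t, ht, ht'⟩ := ih q₂ h1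
      exact ⟨t, ht, by rw [ht', h2, Quiver.Path.comp_cons]⟩

/-- The paths that pass through a vertex of `W`. -/
def pathsThrough (W : Set V) : Set (QuiverPath V) :=
  {p | ∃ w ∈ W, ∃ (s : Quiver.Path p.1 w) (t : Quiver.Path w p.2.1), p.2.2 = s.comp t}

theorem comp_mem_pathsThrough {W : Set V} {a b c : V} (hb : b ∈ W) (p : Quiver.Path a b)
    (q : Quiver.Path b c) : (⟨a, c, p.comp q⟩ : QuiverPath V) ∈ pathsThrough W :=
  ⟨b, hb, p, q, rfl⟩

theorem pathsThrough_mono {W W' : Set V} (h : W ⊆ W') : pathsThrough W ⊆ pathsThrough W' :=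
  fun _ ⟨w, hw, s, t, e⟩ => ⟨w, h hw, s, t, e⟩

theorem pathsThrough_union (W W' : Set V) :
    pathsThrough (W ∪ W') = pathsThrough W ∪ pathsThrough W' := by
  ext p
  constructor
  · rintro ⟨w, hw | hw, s, t, e⟩
    exacts [Or.inl ⟨w, hw, s, t, e⟩, Or.inr ⟨w, hw, s, t, e⟩]
  · rintro (h | h)
    exacts [pathsThrough_mono Set.subset_union_left h, pathsThrough_mono Set.subset_union_right h]

/-- A vertex on a composite path lies on one of the two factors. -/
theorem comp_mem_pathsThrough_iff {W : Set V} {a b c : V} (p : Quiver.Path a b)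
    (q : Quiver.Path b c) :
    (⟨a, c, p.comp q⟩ : QuiverPath V) ∈ pathsThrough W ↔
      (⟨a, b, p⟩ : QuiverPath V) ∈ pathsThrough W ∨
        (⟨b, c, q⟩ : QuiverPath V) ∈ pathsThrough W := by
  constructor
  · rintro ⟨w, hw, s, t, e⟩
    rcases le_total p.length s.length with hl | hl
    · obtain ⟨u, -, hu⟩ := p.exists_comp_of_comp_eq s q t e hl
      exact Or.inr ⟨w, hw, u, t, hu⟩
    · obtain ⟨u, hu, -⟩ := s.exists_comp_of_comp_eq p t q e.symm hl
      exact Or.inl ⟨w, hw, s, u, hu⟩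
  · rintro (⟨w, hw, s, t, e⟩ | ⟨w, hw, s, t, e⟩)
    · exact ⟨w, hw, s, t.comp q, by dsimp only at e ⊢; rw [e, Quiver.Path.comp_assoc]⟩
    · exact ⟨w, hw, p.comp s, t, by dsimp only at e ⊢; rw [e, Quiver.Path.comp_assoc]⟩

/-- A set of paths that contains, with a path, every path of which it is a subpath. -/
def IsPathIdeal (S : Set (QuiverPath V)) : Prop :=
  ∀ ⦃a b c d : V⦄ (s : Quiver.Path a b) (q : Quiver.Path b c) (t : Quiver.Path c d),
    (⟨b, c, q⟩ : QuiverPath V) ∈ S → (⟨a, d, (s.comp q).comp t⟩ : QuiverPath V) ∈ S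

namespace IsPathIdeal

variable {S : Set (QuiverPath V)}

theorem comp_left (hS : IsPathIdeal S) {a b c : V} (s : Quiver.Path a b) {q : Quiver.Path b c}
    (hq : (⟨b, c, q⟩ : QuiverPath V) ∈ S) : (⟨a, c, s.comp q⟩ : QuiverPath V) ∈ S :=
  hS s q Quiver.Path.nil hq

theorem comp_right (hS : IsPathIdeal S) {a b c : V} {q : Quiver.Path a b} (t : Quiver.Path b c)
    (hq : (⟨a, b, q⟩ : QuiverPath V) ∈ S) : (⟨a, c, q.comp t⟩ : QuiverPath V) ∈ S := by
  simpa only [Quiver.Path.nil_comp] using hS Quiver.Path.nil q t hq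

theorem pathsThrough (W : Set V) : IsPathIdeal (pathsThrough W) := fun _ _ _ _ s q t h =>
  (comp_mem_pathsThrough_iff _ t).2 (Or.inl ((comp_mem_pathsThrough_iff s q).2 (Or.inr h)))

end IsPathIdeal

/-- The combinatorial form of heredity: every path of positive length between vertices of `W` lies
in `S`, and two paths outside `S` that meet in a vertex of `W` have their composite outside `S`. -/
structure IsHereditySet (S : Set (QuiverPath V)) (W : Set V) : Prop where
  mem_of_pos : ∀ ⦃a b : V⦄, a ∈ W → b ∈ W → ∀ p : Quiver.Path a b, 0 < p.length →
    (⟨a, b, p⟩ : QuiverPath V) ∈ S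
  comp_notMem : ∀ ⦃a b c : V⦄, b ∈ W → ∀ (p : Quiver.Path a b) (q : Quiver.Path b c),
    (⟨a, b, p⟩ : QuiverPath V) ∉ S → (⟨b, c, q⟩ : QuiverPath V) ∉ S →
      (⟨a, c, p.comp q⟩ : QuiverPath V) ∉ S

/-- Heredity of `W` relative to the paths through `W₀` passes to each single vertex of `W`, once
any set `U` of further vertices has been killed. -/
theorem IsHereditySet.singleton {S : Set (QuiverPath V)} {W₀ W U : Set V}
    (h : IsHereditySet (S ∪ pathsThrough W₀) W) (hU : W₀ ⊆ U) {v : V} (hv : v ∈ W) :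
    IsHereditySet (S ∪ pathsThrough U) {v} where
  mem_of_pos := by
    rintro a b rfl rfl p hp
    exact (h.mem_of_pos hv hv p hp).imp_right fun h => pathsThrough_mono hU h
  comp_notMem := by
    rintro a b c rfl p q hp hq (h' | h')
    · refine h.comp_notMem hv p q (fun h => hp ?_) (fun h => hq ?_) (Or.inl h')
      exacts [h.imp_right fun h => pathsThrough_mono hU h,
        h.imp_right fun h => pathsThrough_mono hU h]
    · exact ((comp_mem_pathsThrough_iff p q).1 h').elim (fun h => hp (Or.inr h))
        fun h => hq (Or.inr h)

/-- The factorization of a path outside `S` at a vertex whose cycles all lie in `S` is unique. -/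
theorem IsPathIdeal.comp_inj {S : Set (QuiverPath V)} (hS : IsPathIdeal S) {v : V}
    (hv : ∀ p : Quiver.Path v v, 0 < p.length → (⟨v, v, p⟩ : QuiverPath V) ∈ S) {a c : V}
    {p p' : Quiver.Path a v} {q q' : Quiver.Path v c} (hp : (⟨a, v, p⟩ : QuiverPath V) ∉ S)
    (hp' : (⟨a, v, p'⟩ : QuiverPath V) ∉ S) (h : p.comp q = p'.comp q') : p = p' ∧ q = q' := by
  have key : ∀ {p p' : Quiver.Path a v} {q q' : Quiver.Path v c},
      (⟨a, v, p'⟩ : QuiverPath V) ∉ S → p.comp q = p'.comp q' → p.length ≤ p'.length →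
        p = p' ∧ q = q' := by
    intro p p' q q' hp' h hl
    obtain ⟨t, rfl, rfl⟩ := p.exists_comp_of_comp_eq p' q q' h hl
    rcases Nat.eq_zero_or_pos t.length with ht | ht
    · rw [Quiver.Path.eq_nil_of_length_zero t ht]
      simp
    · exact absurd (hS.comp_left p (hv t ht)) hp'
  rcases le_total p.length p'.length with hl | hl
  · exact key hp' h hl
  · exact (key hp h.symm hl).imp Eq.symm Eq.symm

end Paths

/-! ### Subspaces of the path algebra spanned by paths -/

section PathSpan

variable {K : Type u} {V : Type v} [Quiver.{w} V] [Field K]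

namespace PathAlgebra

@[simp]
theorem coeff_add (x y : PathAlgebra K V) (p : QuiverPath V) :
    (x + y).coeff p = x.coeff p + y.coeff p := Finsupp.add_apply x y p

@[simp]
theorem coeff_sub (x y : PathAlgebra K V) (p : QuiverPath V) :
    (x - y).coeff p = x.coeff p - y.coeff p := Finsupp.sub_apply x y p

@[simp]
theorem coeff_smul (c : K) (x : PathAlgebra K V) (p : QuiverPath V) :
    (c • x).coeff p = c * x.coeff p := Finsupp.smul_apply c x p

@[simp]
theorem coeff_zero (p : QuiverPath V) : (0 : PathAlgebra K V).coeff p = 0 := rfl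

theorem coeff_sum {ι : Type*} (s : Finset ι) (f : ι → PathAlgebra K V) (p : QuiverPath V) :
    (∑ i ∈ s, f i).coeff p = ∑ i ∈ s, (f i).coeff p := Finsupp.finsetSum_apply s f p

open Classical in
theorem coeff_ofPath (p q : QuiverPath V) : (ofPath K p).coeff q = if p = q then 1 else 0 :=
  Finsupp.single_apply

variable (K) in
/-- The subspace of the path algebra spanned by a set of paths. -/
noncomputable def pathSpan (S : Set (QuiverPath V)) : Submodule K (PathAlgebra K V) :=
  Submodule.span K (ofPath K '' S)

theorem mem_pathSpan_iff {S : Set (QuiverPath V)} {x : PathAlgebra K V} :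
    x ∈ pathSpan K S ↔ ∀ p, x.coeff p ≠ 0 → p ∈ S := by
  have h : pathSpan K S = (Finsupp.supported K K S : Submodule K (QuiverPath V →₀ K)) :=
    (Finsupp.supported_eq_span_single K S).symm
  rw [h]
  refine (Finsupp.mem_supported K x).trans ?_
  exact forall_congr' fun p => imp_congr Finsupp.mem_support_iff Iff.rfl

theorem ofPath_mem_pathSpan {S : Set (QuiverPath V)} {p : QuiverPath V} (hp : p ∈ S) :
    ofPath K p ∈ pathSpan K S := Submodule.subset_span ⟨p, hp, rfl⟩

theorem ofPath_mem_pathSpan_iff {S : Set (QuiverPath V)} {p : QuiverPath V} :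
    ofPath K p ∈ pathSpan K S ↔ p ∈ S := by
  refine ⟨fun h => mem_pathSpan_iff.1 h p ?_, ofPath_mem_pathSpan⟩
  simp [coeff_ofPath]

theorem pathSpan_mono {S T : Set (QuiverPath V)} (h : S ⊆ T) : pathSpan K S ≤ pathSpan K T :=
  Submodule.span_mono (Set.image_mono h)

theorem pathSpan_univ (x : PathAlgebra K V) : x ∈ pathSpan K (Set.univ : Set (QuiverPath V)) :=
  mem_pathSpan_iff.2 fun _ _ => trivial

theorem pathSpan_union (S T : Set (QuiverPath V)) :
    pathSpan K (S ∪ T) = pathSpan K S ⊔ pathSpan K T := by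
  rw [pathSpan, Set.image_union, Submodule.span_union]
  rfl

theorem pathSpan_injective : Function.Injective (pathSpan K : Set (QuiverPath V) → _) := by
  intro S T h
  ext p
  rw [← ofPath_mem_pathSpan_iff (K := K), h, ofPath_mem_pathSpan_iff]

theorem mul_mem_pathSpan [Fintype V] {S T U : Set (QuiverPath V)} {x y : PathAlgebra K V}
    (h : ∀ ⦃a b c : V⦄ (p : Quiver.Path a b) (q : Quiver.Path b c), (⟨a, b, p⟩ : QuiverPath V) ∈ S →
      (⟨b, c, q⟩ : QuiverPath V) ∈ T → (⟨a, c, p.comp q⟩ : QuiverPath V) ∈ U)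
    (hx : x ∈ pathSpan K S) (hy : y ∈ pathSpan K T) : x * y ∈ pathSpan K U := by
  induction hx using Submodule.span_induction with
  | zero => rw [zero_mul]; exact zero_mem _
  | add x x' _ _ hx hx' => rw [add_mul]; exact add_mem hx hx'
  | smul c x _ hx => rw [smul_mul_assoc]; exact Submodule.smul_mem _ c hx
  | mem x hx =>
    obtain ⟨⟨a, b, p⟩, hp, rfl⟩ := hx
    induction hy using Submodule.span_induction with
    | zero => rw [mul_zero]; exact zero_mem _
    | add x x' _ _ hx hx' => rw [mul_add]; exact add_mem hx hx'
    | smul c x _ hx => rw [mul_smul_comm]; exact Submodule.smul_mem _ c hx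
    | mem y hy =>
      obtain ⟨⟨b', c, q⟩, hq, rfl⟩ := hy
      by_cases hb : b = b'
      · subst hb
        rw [ofPath_mul_comp]
        exact ofPath_mem_pathSpan (h p q hp hq)
      · rw [ofPath_mul_of_ne p q hb]
        exact zero_mem _

theorem vertex_mul_mem_pathSpan [Fintype V] {S : Set (QuiverPath V)} {x : PathAlgebra K V}
    (hx : x ∈ pathSpan K S) (a : V) : vertex K a * x ∈ pathSpan K {p | p ∈ S ∧ p.1 = a} := by
  refine mul_mem_pathSpan (S := {⟨a, a, Quiver.Path.nil⟩}) (fun a' b c p q hp hq => ?_)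
    (ofPath_mem_pathSpan rfl) hx
  cases hp
  simpa using hq

theorem mul_vertex_mem_pathSpan [Fintype V] {S : Set (QuiverPath V)} {x : PathAlgebra K V}
    (hx : x ∈ pathSpan K S) (b : V) : x * vertex K b ∈ pathSpan K {p | p ∈ S ∧ p.2.1 = b} := by
  refine mul_mem_pathSpan (T := {⟨b, b, Quiver.Path.nil⟩}) (fun a' b c p q hp hq => ?_)
    hx (ofPath_mem_pathSpan rfl)
  cases hq
  simpa using hp

theorem vertex_mul_ofPath {a b : V} (p : Quiver.Path a b) :
    vertex K a * ofPath K ⟨a, b, p⟩ = ofPath K ⟨a, b, p⟩ := by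
  rw [vertex, ofPath_mul_comp, Quiver.Path.nil_comp]

theorem ofPath_mul_vertex {a b : V} (p : Quiver.Path a b) :
    ofPath K ⟨a, b, p⟩ * vertex K b = ofPath K ⟨a, b, p⟩ := by
  rw [vertex, ofPath_mul_comp, Quiver.Path.comp_nil]

theorem vertex_mul_self (a : V) : vertex K a * vertex K a = vertex K a :=
  vertex_mul_ofPath Quiver.Path.nil

theorem vertex_mul_vertex_of_ne {a b : V} (h : a ≠ b) : vertex K a * vertex K b = 0 :=
  ofPath_mul_of_ne _ _ h

theorem mul_mem_pathSpan_left [Fintype V] {S : Set (QuiverPath V)} (hS : IsPathIdeal S)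
    (x : PathAlgebra K V) {y : PathAlgebra K V} (hy : y ∈ pathSpan K S) : x * y ∈ pathSpan K S :=
  mul_mem_pathSpan (fun _ _ _ p _ _ hq => hS.comp_left p hq) (pathSpan_univ x) hy

theorem mul_mem_pathSpan_right [Fintype V] {S : Set (QuiverPath V)} (hS : IsPathIdeal S)
    {x : PathAlgebra K V} (y : PathAlgebra K V) (hx : x ∈ pathSpan K S) : x * y ∈ pathSpan K S :=
  mul_mem_pathSpan (fun _ _ _ _ q hp _ => hS.comp_right q hp) hx (pathSpan_univ y)

/-- The two-sided ideal of the path algebra spanned by a set of paths that is closed under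
composition with arbitrary paths. -/
noncomputable def pathIdeal [Fintype V] (S : Set (QuiverPath V)) (hS : IsPathIdeal S) :
    TwoSidedIdeal (PathAlgebra K V) :=
  .mk' (pathSpan K S) (zero_mem _) add_mem neg_mem (fun h => mul_mem_pathSpan_left hS _ h)
    (fun h => mul_mem_pathSpan_right hS _ h)

theorem mem_pathIdeal [Fintype V] {S : Set (QuiverPath V)} {hS : IsPathIdeal S}
    {x : PathAlgebra K V} : x ∈ pathIdeal S hS ↔ x ∈ pathSpan K S :=
  TwoSidedIdeal.mem_mk' ..

theorem span_ofPath_image [Fintype V] {S : Set (QuiverPath V)} (hS : IsPathIdeal S) :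
    TwoSidedIdeal.span (ofPath K '' S) = pathIdeal S hS := by
  apply le_antisymm
  · rw [TwoSidedIdeal.span_le]
    rintro _ ⟨p, hp, rfl⟩
    exact mem_pathIdeal.2 (ofPath_mem_pathSpan hp)
  · intro x hx
    rw [mem_pathIdeal] at hx
    induction hx using Submodule.span_induction with
    | zero => exact zero_mem _
    | add x x' _ _ hx hx' => exact add_mem hx hx'
    | smul c x _ hx =>
      rw [Algebra.smul_def]
      exact TwoSidedIdeal.mul_mem_left _ _ _ hx
    | mem x hx => exact TwoSidedIdeal.subset_span hx

end PathAlgebra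

end PathSpan

/-! ### Quotients of the path algebra -/

section Quotients

variable {K : Type u} {V : Type v} [Quiver.{w} V] [Field K] [Fintype V] {R : Type*} [Ring R]

namespace PathAlgebra

/-- The two-sided ideal generated by the images of the vertices in `W`. -/
def vertexIdeal (φ : PathAlgebra K V →+* R) (W : Set V) : TwoSidedIdeal R :=
  TwoSidedIdeal.span ((fun v => φ (vertex K v)) '' W)

theorem map_vertex_mem_vertexIdeal (φ : PathAlgebra K V →+* R) {W : Set V} {v : V} (hv : v ∈ W) :
    φ (vertex K v) ∈ vertexIdeal φ W := TwoSidedIdeal.subset_span ⟨v, hv, rfl⟩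

theorem map_smul_eq (φ : PathAlgebra K V →+* R) (c : K) (x : PathAlgebra K V) :
    φ (c • x) = φ (algebraMap K _ c) * φ x := by rw [Algebra.smul_def, map_mul]

theorem map_smul_eq_zero (φ : PathAlgebra K V →+* R) (c : K) {x : PathAlgebra K V} (hx : φ x = 0) :
    φ (c • x) = 0 := by rw [map_smul_eq, hx, mul_zero]

theorem map_mem_of_mem_pathSpan (φ : PathAlgebra K V →+* R) {S : Set (QuiverPath V)}
    {N : Ideal R} (h : ∀ p ∈ S, φ (ofPath K p) ∈ N) {x : PathAlgebra K V}
    (hx : x ∈ pathSpan K S) : φ x ∈ N := by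
  induction hx using Submodule.span_induction with
  | zero => rw [map_zero]; exact zero_mem _
  | add x x' _ _ hx hx' => rw [map_add]; exact add_mem hx hx'
  | smul c x _ hx => rw [map_smul_eq]; exact N.mul_mem_left _ hx
  | mem x hx =>
    obtain ⟨p, hp, rfl⟩ := hx
    exact h p hp

theorem map_eq_zero_of_mem_pathSpan (φ : PathAlgebra K V →+* R) {S : Set (QuiverPath V)}
    (h : ∀ p ∈ S, φ (ofPath K p) = 0) {x : PathAlgebra K V} (hx : x ∈ pathSpan K S) : φ x = 0 :=
  map_mem_of_mem_pathSpan φ (N := ⊥) h hx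

/-- A subspace spanned by paths can be replaced, modulo the kernel of `φ`, by another one as soon
as this can be done for each of the spanning paths. -/
theorem exists_mem_pathSpan_map_eq (φ : PathAlgebra K V →+* R) {S T : Set (QuiverPath V)}
    (h : ∀ p ∈ S, ∃ z ∈ pathSpan K T, φ (ofPath K p) = φ z) {x : PathAlgebra K V}
    (hx : x ∈ pathSpan K S) : ∃ z ∈ pathSpan K T, φ x = φ z := by
  induction hx using Submodule.span_induction with
  | zero => exact ⟨0, zero_mem _, rfl⟩
  | add x x' _ _ hx hx' =>
    obtain ⟨z, hz, e⟩ := hx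
    obtain ⟨z', hz', e'⟩ := hx'
    exact ⟨z + z', add_mem hz hz', by rw [map_add, map_add, e, e']⟩
  | smul c x _ hx =>
    obtain ⟨z, hz, e⟩ := hx
    exact ⟨c • z, Submodule.smul_mem _ c hz, by rw [map_smul_eq, map_smul_eq, e]⟩
  | mem x hx =>
    obtain ⟨p, hp, rfl⟩ := hx
    exact h p hp

/-- The ideal generated by the vertices in `W` is the image of the span of the paths through `W`. -/
theorem mem_vertexIdeal_iff {φ : PathAlgebra K V →+* R} (hφ : Function.Surjective φ) {W : Set V}
    {x : R} : x ∈ vertexIdeal φ W ↔ ∃ z ∈ pathSpan K (pathsThrough W), φ z = x := by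
  constructor
  · intro hx
    induction hx using TwoSidedIdeal.span_induction with
    | mem x hx =>
      obtain ⟨v, hv, rfl⟩ := hx
      exact ⟨_, ofPath_mem_pathSpan (comp_mem_pathsThrough hv Quiver.Path.nil Quiver.Path.nil), rfl⟩
    | zero => exact ⟨0, zero_mem _, map_zero φ⟩
    | add x y _ _ hx hy =>
      obtain ⟨z, hz, rfl⟩ := hx
      obtain ⟨z', hz', rfl⟩ := hy
      exact ⟨z + z', add_mem hz hz', map_add φ _ _⟩
    | neg x _ hx =>
      obtain ⟨z, hz, rfl⟩ := hx
      exact ⟨-z, neg_mem hz, map_neg φ _⟩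
    | left_absorb a x _ hx =>
      obtain ⟨z, hz, rfl⟩ := hx
      obtain ⟨a, rfl⟩ := hφ a
      exact ⟨a * z, mul_mem_pathSpan_left (.pathsThrough W) a hz, map_mul φ _ _⟩
    | right_absorb a x _ hx =>
      obtain ⟨z, hz, rfl⟩ := hx
      obtain ⟨a, rfl⟩ := hφ a
      exact ⟨z * a, mul_mem_pathSpan_right (.pathsThrough W) a hz, map_mul φ _ _⟩
  · rintro ⟨z, hz, rfl⟩
    refine map_mem_of_mem_pathSpan φ (N := (vertexIdeal φ W).asIdeal) ?_ hz
    rintro ⟨a, b, p⟩ ⟨v, hv, s, t, e⟩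
    dsimp only at s t e
    rw [e, ← ofPath_mul_comp, ← ofPath_mul_vertex s, map_mul, map_mul]
    exact TwoSidedIdeal.mul_mem_right _ _ _
      (TwoSidedIdeal.mul_mem_left _ _ _ (map_vertex_mem_vertexIdeal φ hv))

/-- If long paths vanish in the quotient, paths of positive length lie in its Jacobson radical. -/
theorem map_ofPath_mem_jacobson {φ : PathAlgebra K V →+* R} (hφ : Function.Surjective φ) {m : ℕ}
    (hm : ∀ p : QuiverPath V, m ≤ p.2.2.length → φ (ofPath K p) = 0) {p : QuiverPath V}
    (hp : 0 < p.2.2.length) : φ (ofPath K p) ∈ Ring.jacobson R := by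
  rw [← Ideal.jacobson_bot, Ideal.mem_jacobson_iff]
  intro y
  obtain ⟨y, rfl⟩ := hφ y
  -- a left multiple of `p` is a combination of paths of positive length, hence nilpotent
  have h1 : y * ofPath K p ∈ pathSpan K {q : QuiverPath V | 1 ≤ q.2.2.length} := by
    refine mul_mem_pathSpan (fun a b c s t _ ht => ?_) (pathSpan_univ y)
      (ofPath_mem_pathSpan (Set.mem_singleton p))
    rw [Set.mem_singleton_iff] at ht
    subst ht
    dsimp only at hp
    simp only [Set.mem_ofPred_eq, Quiver.Path.length_comp]
    omega
  have h2 : ∀ k : ℕ, (y * ofPath K p) ^ k ∈ pathSpan K {q : QuiverPath V | k ≤ q.2.2.length} := by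
    intro k
    induction k with
    | zero =>
      refine pathSpan_mono (fun q _ => ?_) (pathSpan_univ _)
      exact Nat.zero_le _
    | succ k ih =>
      rw [pow_succ]
      refine mul_mem_pathSpan (fun a b c s t hs ht => ?_) ih h1
      simp only [Set.mem_ofPred_eq, Quiver.Path.length_comp] at hs ht ⊢
      omega
  have h3 : IsNilpotent (φ y * φ (ofPath K p)) :=
    ⟨m, by rw [← map_mul, ← map_pow]; exact map_eq_zero_of_mem_pathSpan φ hm (h2 m)⟩
  obtain ⟨u, hu⟩ := h3.isUnit_one_add
  refine ⟨(u⁻¹ : Rˣ), ?_⟩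
  have h4 : (↑u⁻¹ : R) * (1 + φ y * φ (ofPath K p)) = 1 := by rw [← hu, Units.inv_mul]
  rw [mul_add, mul_one, ← mul_assoc] at h4
  rw [Ideal.mem_bot, add_comm, h4, sub_self]

/-- Separation of the constant term: between two vertices, an element of the path algebra is a
multiple of the vertex (if both agree) plus a combination of paths of positive length. -/
theorem exists_vertex_mul_mul_vertex (x : PathAlgebra K V) (a b : V) :
    ∃ (c : K), ∃ y ∈ pathSpan K {p : QuiverPath V | p.1 = a ∧ p.2.1 = b ∧ 0 < p.2.2.length},
      vertex K a * x * vertex K b = c • (vertex K a * vertex K b) + y := by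
  induction x using induction_on with
  | zero => exact ⟨0, 0, zero_mem _, by simp⟩
  | add x x' hx hx' =>
    obtain ⟨c, y, hy, e⟩ := hx
    obtain ⟨c', y', hy', e'⟩ := hx'
    refine ⟨c + c', y + y', add_mem hy hy', ?_⟩
    rw [mul_add, add_mul, e, e', add_smul]
    abel
  | smul k p =>
    suffices h : ∃ (c : K), ∃ y ∈ pathSpan K
        {p : QuiverPath V | p.1 = a ∧ p.2.1 = b ∧ 0 < p.2.2.length},
        vertex K a * ofPath K p * vertex K b = c • (vertex K a * vertex K b) + y by
      obtain ⟨c, y, hy, e⟩ := h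
      exact ⟨k * c, k • y, Submodule.smul_mem _ k hy, by
        rw [mul_smul_comm, smul_mul_assoc, e, smul_add, mul_smul]⟩
    obtain ⟨s, t, p⟩ := p
    by_cases hs : s = a
    · subst hs
      rw [vertex_mul_ofPath]
      by_cases ht : t = b
      · subst ht
        rw [ofPath_mul_vertex]
        rcases Nat.eq_zero_or_pos p.length with h | h
        · obtain rfl := Quiver.Path.eq_of_length_zero p h
          rw [Quiver.Path.eq_nil_of_length_zero p h]
          exact ⟨1, 0, zero_mem _, by rw [vertex_mul_self, one_smul, add_zero]; rfl⟩
        · exact ⟨0, _, ofPath_mem_pathSpan ⟨rfl, rfl, h⟩, by rw [zero_smul, zero_add]⟩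
      · exact ⟨0, 0, zero_mem _, by rw [vertex, ofPath_mul_of_ne _ _ ht]; simp⟩
    · exact ⟨0, 0, zero_mem _, by
        rw [vertex, ofPath_mul_of_ne _ _ (Ne.symm hs), zero_mul]; simp⟩

/-- If all paths of positive length from `a` to `b` vanish in the quotient, only multiples of
vertices are left between `a` and `b`. -/
theorem exists_map_vertex_mul_mul_vertex {φ : PathAlgebra K V →+* R} (hφ : Function.Surjective φ)
    {a b : V} (h : ∀ p : Quiver.Path a b, 0 < p.length → φ (ofPath K ⟨a, b, p⟩) = 0) (x : R) :
    ∃ c : K, φ (vertex K a) * x * φ (vertex K b) = φ (c • (vertex K a * vertex K b)) := by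
  obtain ⟨x, rfl⟩ := hφ x
  obtain ⟨c, y, hy, e⟩ := exists_vertex_mul_mul_vertex x a b
  refine ⟨c, ?_⟩
  rw [← map_mul, ← map_mul, e, map_add, map_eq_zero_of_mem_pathSpan φ _ hy, add_zero]
  rintro ⟨_, _, p⟩ ⟨rfl, rfl, hp⟩
  exact h p hp

end PathAlgebra

end Quotients

/-! ### Reducible paths and normal forms -/

section Reduction

variable {K : Type u} {V : Type v} [Quiver.{w} V] [Field K] [Fintype V] {R : Type*} [Ring R]
  {r : QuiverPath V → QuiverPath V → Prop}

/-- The paths that, modulo the kernel of `φ`, are combinations of smaller paths with the same end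
points. These are the tips of the non-zero elements of the kernel, see
`mem_reduciblePaths_iff_exists_isTip`. -/
def reduciblePaths (r : QuiverPath V → QuiverPath V → Prop) (φ : PathAlgebra K V →+* R) :
    Set (QuiverPath V) :=
  {p | ∃ y ∈ pathSpan K {q | r q p ∧ q.1 = p.1 ∧ q.2.1 = p.2.1}, φ (ofPath K p) = φ y}

theorem isPathIdeal_reduciblePaths (hr : IsAdmissibleOrder r) (φ : PathAlgebra K V →+* R) :
    IsPathIdeal (reduciblePaths r φ) := by
  rintro a b c d s q t ⟨y, hy, e⟩
  refine ⟨ofPath K ⟨a, b, s⟩ * y * ofPath K ⟨c, d, t⟩, ?_, ?_⟩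
  · have h1 : ofPath K ⟨a, b, s⟩ * y ∈
        pathSpan K {q' | r q' ⟨a, c, s.comp q⟩ ∧ q'.1 = a ∧ q'.2.1 = c} := by
      refine mul_mem_pathSpan ?_ (ofPath_mem_pathSpan (Set.mem_singleton _)) hy
      rintro a' b' c' p p' hp ⟨h1, h2, h3⟩
      dsimp only at h2 h3
      subst h2 h3
      rw [Set.mem_singleton_iff] at hp
      cases hp
      exact ⟨hr.comp_left s p' q h1, rfl, rfl⟩
    refine mul_mem_pathSpan ?_ h1 (ofPath_mem_pathSpan (Set.mem_singleton _))
    rintro a' b' c' p p' ⟨h1, h2, h3⟩ hp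
    dsimp only at h2 h3
    subst h2 h3
    rw [Set.mem_singleton_iff] at hp
    cases hp
    exact ⟨hr.comp_right p _ t h1, rfl, rfl⟩
  · rw [← ofPath_mul_comp, ← ofPath_mul_comp]
    simp only [map_mul, e]

theorem mem_reduciblePaths_iff_exists_isTip (hr : IsAdmissibleOrder r)
    (φ : PathAlgebra K V →+* R) (p : QuiverPath V) :
    p ∈ reduciblePaths r φ ↔ ∃ x, φ x = 0 ∧ IsTip r x p := by
  have := hr.isWellOrder
  constructor
  · rintro ⟨y, hy, e⟩
    have hy' := mem_pathSpan_iff.1 hy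
    refine ⟨ofPath K p - y, by rw [map_sub, e, sub_self], ?_, fun q hq => ?_⟩
    · have : y.coeff p = 0 := by
        by_contra h
        exact irrefl _ (hy' p h).1
      simp [coeff_ofPath, this]
    · by_cases h : p = q
      · exact Or.inl h.symm
      · refine Or.inr (hy' q fun h' => hq ?_).1
        simp [coeff_ofPath, h, h']
  · rintro ⟨x, hx, hp, hlt⟩
    obtain ⟨a, b, p⟩ := p
    -- split off the tip and cut the remainder down to paths from `a` to `b`
    set c := x.coeff ⟨a, b, p⟩ with hc
    set x' := x - c • ofPath K ⟨a, b, p⟩ with hx'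
    have h1 : x' ∈ pathSpan K {q | r q ⟨a, b, p⟩} := by
      refine mem_pathSpan_iff.2 fun q hq => ?_
      by_cases h : (⟨a, b, p⟩ : QuiverPath V) = q
      · subst h
        simp [hx', coeff_ofPath, ← hc] at hq
      · simp only [hx', coeff_sub, coeff_smul, coeff_ofPath, h, if_false, mul_zero, sub_zero] at hq
        exact (hlt q hq).resolve_left (Ne.symm h)
    have h2 := mul_vertex_mem_pathSpan (vertex_mul_mem_pathSpan h1 a) b
    refine ⟨-(c⁻¹ • (vertex K a * x' * vertex K b)), neg_mem (Submodule.smul_mem _ _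
      (pathSpan_mono ?_ h2)), ?_⟩
    · rintro q ⟨⟨h1, h2⟩, h3⟩
      exact ⟨h1, h2, h3⟩
    · have h3 : vertex K a * x * vertex K b =
          c • ofPath K ⟨a, b, p⟩ + vertex K a * x' * vertex K b := by
        rw [hx', mul_sub, sub_mul, mul_smul_comm, smul_mul_assoc, vertex_mul_ofPath,
          ofPath_mul_vertex]
        abel
      have h4 : ofPath K ⟨a, b, p⟩ = c⁻¹ • (vertex K a * x * vertex K b) +
          -(c⁻¹ • (vertex K a * x' * vertex K b)) := by
        rw [h3, smul_add, smul_smul, inv_mul_cancel₀ hp, one_smul]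
        abel
      conv_lhs => rw [h4, map_add]
      rw [map_smul_eq_zero φ c⁻¹, zero_add]
      rw [map_mul, map_mul, hx, mul_zero, zero_mul]

theorem exists_isTip (hr : IsAdmissibleOrder r) {x : PathAlgebra K V} (hx : x ≠ 0) :
    ∃ p, IsTip r x p := by
  classical
  have := hr.isWellOrder
  let _ := linearOrderOfSTO r
  have hne : (show QuiverPath V →₀ K from x).support.Nonempty := Finsupp.support_nonempty_iff.2 hx
  obtain ⟨p, hp, hmax⟩ := Finset.exists_max_image _ id hne
  exact ⟨p, Finsupp.mem_support_iff.1 hp, fun q hq =>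
    (hmax q (Finsupp.mem_support_iff.2 hq)).eq_or_lt⟩

/-- The irreducible paths are linearly independent modulo the kernel. -/
theorem eq_zero_of_mem_pathSpan_irreducible (hr : IsAdmissibleOrder r) {φ : PathAlgebra K V →+* R}
    {x : PathAlgebra K V} (hx : x ∈ pathSpan K (reduciblePaths r φ)ᶜ) (h : φ x = 0) : x = 0 := by
  by_contra hne
  obtain ⟨p, hp⟩ := exists_isTip hr hne
  exact mem_pathSpan_iff.1 hx p hp.1 ((mem_reduciblePaths_iff_exists_isTip hr φ p).2 ⟨x, h, hp⟩)

/-- Existence of normal forms: the irreducible paths span, end point by end point. -/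
theorem exists_normalForm (hr : IsAdmissibleOrder r) (φ : PathAlgebra K V →+* R)
    (p : QuiverPath V) :
    ∃ y ∈ pathSpan K {q | q ∉ reduciblePaths r φ ∧ q.1 = p.1 ∧ q.2.1 = p.2.1},
      φ (ofPath K p) = φ y := by
  have := hr.isWellOrder
  induction p using (IsWellFounded.wf (r := r)).induction with
  | _ p ih =>
    by_cases hp : p ∈ reduciblePaths r φ
    · obtain ⟨y, hy, e⟩ := hp
      rw [e]
      refine exists_mem_pathSpan_map_eq φ (fun q hq => ?_) hy
      obtain ⟨hqp, h1, h2⟩ := hq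
      obtain ⟨z, hz, e⟩ := ih q hqp
      refine ⟨z, pathSpan_mono ?_ hz, e⟩
      rintro q' ⟨h, h1', h2'⟩
      exact ⟨h, h1'.trans h1, h2'.trans h2⟩
    · exact ⟨_, ofPath_mem_pathSpan ⟨hp, rfl, rfl⟩, rfl⟩

/-- If the kernel is spanned by the path ideal `S`, the reducible paths are those in `S`. -/
theorem reduciblePaths_eq_of_ker (hr : IsAdmissibleOrder r) {φ : PathAlgebra K V →+* R}
    {S : Set (QuiverPath V)} (hS : ∀ x, φ x = 0 ↔ x ∈ pathSpan K S) :
    reduciblePaths r φ = S := by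
  ext p
  rw [mem_reduciblePaths_iff_exists_isTip hr]
  constructor
  · rintro ⟨x, hx, hp⟩
    exact mem_pathSpan_iff.1 ((hS x).1 hx) p hp.1
  · intro hp
    refine ⟨ofPath K p, (hS _).2 (ofPath_mem_pathSpan hp), by simp [coeff_ofPath], fun q hq => ?_⟩
    refine Or.inl (by_contra fun h => hq ?_)
    simp [coeff_ofPath, Ne.symm h]

end Reduction

/-! ### Ideals generated by an idempotent -/

section Idempotents

variable {R : Type*} [Ring R]

/-- The Jacobson radical contains no non-zero idempotent. -/
theorem eq_zero_of_mem_jacobson_of_mul_self {e : R} (he : e * e = e) (h : e ∈ Ring.jacobson R) :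
    e = 0 := by
  rw [← Ideal.jacobson_bot, Ideal.mem_jacobson_iff] at h
  obtain ⟨z, hz⟩ := h (-1)
  rw [Ideal.mem_bot] at hz
  have h1 : (z * -1 * e + z - 1) * e = -e := by
    rw [sub_mul, add_mul, mul_assoc (z * -1), he]
    noncomm_ring
  rw [hz, zero_mul] at h1
  exact neg_eq_zero.1 h1.symm

theorem span_singleton_mul_self {e : R} (he : e * e = e) :
    (TwoSidedIdeal.span {e}).asIdeal * (TwoSidedIdeal.span {e}).asIdeal =
      (TwoSidedIdeal.span {e}).asIdeal := by
  refine le_antisymm Ideal.mul_le_right ?_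
  set L := TwoSidedIdeal.span {e}
  have hL : L ≤ (L.asIdeal * L.asIdeal).toTwoSided := by
    rw [TwoSidedIdeal.span_le, Set.singleton_subset_iff, SetLike.mem_coe, Ideal.mem_toTwoSided,
      ← he]
    exact Ideal.mul_mem_mul (TwoSidedIdeal.subset_span rfl) (TwoSidedIdeal.subset_span rfl)
  exact fun x hx => Ideal.mem_toTwoSided.1 (hL hx)

theorem span_singleton_mul_mul_eq_bot {e : R} {J : Ideal R} [J.IsTwoSided]
    (h : ∀ j ∈ J, e * j * e = 0) :
    (TwoSidedIdeal.span {e}).asIdeal * J * (TwoSidedIdeal.span {e}).asIdeal = ⊥ := by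
  have h1 : ∀ y ∈ TwoSidedIdeal.span {e}, ∀ j ∈ J, e * j * y = 0 := by
    intro y hy
    induction hy using TwoSidedIdeal.span_induction with
    | mem y hy => exact fun j hj => hy ▸ h j hj
    | zero => exact fun j _ => mul_zero _
    | add x y _ _ hx hy => exact fun j hj => by rw [mul_add, hx j hj, hy j hj, add_zero]
    | neg x _ hx => exact fun j hj => by rw [mul_neg, hx j hj, neg_zero]
    | left_absorb a x _ hx =>
      exact fun j hj => by
        rw [← mul_assoc, mul_assoc e, hx _ (Ideal.mul_mem_right _ _ hj)]
    | right_absorb a x _ hx => exact fun j hj => by rw [← mul_assoc, hx j hj, zero_mul]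
  have h2 : ∀ x ∈ TwoSidedIdeal.span {e}, ∀ y ∈ TwoSidedIdeal.span {e}, ∀ j ∈ J,
      x * j * y = 0 := by
    intro x hx y hy
    induction hx using TwoSidedIdeal.span_induction with
    | mem x hx => exact fun j hj => Set.mem_singleton_iff.1 hx ▸ h1 y hy j hj
    | zero => exact fun j _ => by rw [zero_mul, zero_mul]
    | add x x' _ _ hx hy =>
      exact fun j hj => by rw [add_mul, add_mul, hx j hj, hy j hj, add_zero]
    | neg x _ hx => exact fun j hj => by rw [neg_mul, neg_mul, hx j hj, neg_zero]
    | left_absorb a x _ hx =>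
      exact fun j hj => by rw [mul_assoc, mul_assoc, ← mul_assoc x, hx j hj, mul_zero]
    | right_absorb a x _ hx =>
      exact fun j hj => by rw [mul_assoc x, hx _ (Ideal.mul_mem_left _ _ hj)]
  rw [eq_bot_iff, Ideal.mul_le]
  intro z hz y hy
  rw [Ideal.mem_bot]
  induction hz using Submodule.mul_induction_on' with
  | mem_mul_mem x hx j hj => exact h2 x hx y hy j hj
  | add x _ x' _ hx hx' => rw [add_mul, hx, hx', add_zero]

/-- A two-sided ideal that is, as a left ideal, a direct sum of copies `R e b i` of `R e` for an
idempotent `e`, is a projective left module. -/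
theorem projective_of_direct_sum {L : TwoSidedIdeal R} {e : R} (he : e * e = e) {ι : Type*}
    {b : ι → R} (heb : ∀ i, e * b i = b i) (hb : ∀ i, b i ∈ L)
    (hspan : ∀ x ∈ L, x ∈ Ideal.span (Set.range b))
    (hind : ∀ f : ι →₀ R, (∀ i, f i * e = f i) → f.sum (fun i a => a * b i) = 0 → f = 0) :
    Module.Projective R L := by
  have hP : Module.Projective R (Ideal.span {e}) := by
    refine Module.Projective.of_split (Ideal.span {e}).subtype
      (LinearMap.toSpanSingleton R (Ideal.span {e}) ⟨e, Ideal.mem_span_singleton_self e⟩) ?_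
    ext ⟨x, hx⟩
    obtain ⟨y, rfl⟩ := Ideal.mem_span_singleton'.1 hx
    simp [mul_assoc, he]
  let F : (ι →₀ Ideal.span {e}) →ₗ[R] L := Finsupp.lsum ℕ fun i =>
    (LinearMap.toSpanSingleton R L ⟨b i, hb i⟩) ∘ₗ (Ideal.span {e}).subtype
  have hF : ∀ f : ι →₀ Ideal.span {e}, (F f : R) = f.sum fun i a => (a : R) * b i := by
    intro f
    simp only [F, Finsupp.lsum_apply, Finsupp.sum]
    refine (map_sum (TwoSidedIdeal.subtype L) _ _).trans ?_
    rfl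
  classical
  have hQ : Module.Projective R (ι →₀ Ideal.span {e}) :=
    Module.Projective.of_equiv (finsuppLEquivDirectSum R (Ideal.span {e}) ι).symm
  refine Module.Projective.of_equiv (LinearEquiv.ofBijective F ⟨?_, ?_⟩)
  · rw [← LinearMap.ker_eq_bot, LinearMap.ker_eq_bot']
    intro f hf
    have h1 : f.mapRange (Subtype.val : Ideal.span {e} → R) rfl = 0 := by
      refine hind _ (fun i => ?_) ?_
      · obtain ⟨y, hy⟩ := Ideal.mem_span_singleton'.1 (f i).2
        rw [Finsupp.mapRange_apply, ← hy, mul_assoc, he]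
      · rw [Finsupp.sum_mapRange_index (fun i => zero_mul _), ← hF, hf]
        rfl
    ext i
    exact DFunLike.congr_fun h1 i
  · rintro ⟨x, hx⟩
    obtain ⟨c, hc⟩ := (Finsupp.mem_span_range_iff_exists_finsupp).1 (hspan x hx)
    refine ⟨c.mapRange (fun a => ⟨a * e, Ideal.mul_mem_left _ _
      (Ideal.mem_span_singleton_self e)⟩) (by simp), Subtype.ext ?_⟩
    rw [hF, Finsupp.sum_mapRange_index (fun i => zero_mul _)]
    refine Eq.trans ?_ hc
    simp only [mul_assoc, heb, smul_eq_mul]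

end Idempotents

/-! ### Heredity ideals generated by a vertex -/

section HeredityVertex

variable {K : Type u} {V : Type v} [Quiver.{w} V] [Field K] [Fintype V] {R : Type*} [Ring R]
  {r : QuiverPath V → QuiverPath V → Prop} {φ : PathAlgebra K V →+* R} {v : V}

/-- If all cycles of positive length at `v` are reducible, they vanish: their normal form is a
multiple of the idempotent `v`, and they lie in the radical. -/
theorem map_cycle_eq_zero (hr : IsAdmissibleOrder r) (hφ : Function.Surjective φ) {m : ℕ}
    (hm : ∀ p : QuiverPath V, m ≤ p.2.2.length → φ (ofPath K p) = 0)
    (hv : IsHereditySet (reduciblePaths r φ) {v}) (p : Quiver.Path v v) (hp : 0 < p.length) :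
    φ (ofPath K ⟨v, v, p⟩) = 0 := by
  obtain ⟨y, hy, e⟩ := exists_normalForm hr φ ⟨v, v, p⟩
  -- the only path from `v` to `v` that can be irreducible is `v` itself
  have h1 : y ∈ pathSpan K {(⟨v, v, Quiver.Path.nil⟩ : QuiverPath V)} := by
    refine pathSpan_mono ?_ hy
    rintro ⟨_, _, q⟩ ⟨hq, h1, h2⟩
    dsimp only at h1 h2
    subst h1 h2
    rcases Nat.eq_zero_or_pos q.length with h | h
    · rw [Quiver.Path.eq_nil_of_length_zero q h]
      rfl
    · exact absurd (hv.mem_of_pos rfl rfl q h) hq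
  rw [pathSpan, Set.image_singleton, Submodule.mem_span_singleton] at h1
  obtain ⟨c, rfl⟩ := h1
  by_cases hc : c = 0
  · rw [e, hc, zero_smul, map_zero]
  · have h2 : φ (vertex K v) = φ (algebraMap K _ c⁻¹) * φ (ofPath K ⟨v, v, p⟩) := by
      rw [e, ← map_smul_eq, smul_smul, inv_mul_cancel₀ hc, one_smul]
      rfl
    have h3 : φ (vertex K v) = 0 := by
      refine eq_zero_of_mem_jacobson_of_mul_self (by rw [← map_mul, vertex_mul_self]) ?_
      rw [h2]
      exact Ideal.mul_mem_left _ _ (map_ofPath_mem_jacobson hφ hm hp)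
    rw [← vertex_mul_ofPath, map_mul, h3, zero_mul]

/-- Factorizations through `v` into irreducible paths are unique, so coefficients of a product can
be read off. -/
theorem coeff_mul_ofPath_irreducible (hr : IsAdmissibleOrder r)
    (hv : IsHereditySet (reduciblePaths r φ) {v}) {y : PathAlgebra K V}
    (hy : y ∈ pathSpan K {p : QuiverPath V | p ∉ reduciblePaths r φ ∧ p.2.1 = v}) {a b b' : V}
    {p : Quiver.Path a v} (hp : (⟨a, v, p⟩ : QuiverPath V) ∉ reduciblePaths r φ)
    (q : Quiver.Path v b) (q' : Quiver.Path v b') :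
    (y * ofPath K ⟨v, b', q'⟩).coeff ⟨a, b, p.comp q⟩ =
      open Classical in
      if (⟨v, b', q'⟩ : QuiverPath V) = ⟨v, b, q⟩ then y.coeff ⟨a, v, p⟩ else 0 := by
  classical
  induction hy using Submodule.span_induction with
  | zero => simp
  | add x x' _ _ hx hx' =>
    rw [add_mul, coeff_add, hx, hx', coeff_add]
    split_ifs <;> simp
  | smul c x _ hx =>
    rw [smul_mul_assoc, coeff_smul, hx, coeff_smul]
    split_ifs <;> simp
  | mem x hx =>
    obtain ⟨⟨a', _, p'⟩, ⟨hp', rfl⟩, rfl⟩ := hx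
    dsimp only at *
    rw [ofPath_mul_comp, coeff_ofPath, coeff_ofPath]
    by_cases h : (⟨a', b', p'.comp q'⟩ : QuiverPath V) = ⟨a, b, p.comp q⟩
    · obtain ⟨rfl, h⟩ := Sigma.mk.inj_iff.1 h
      obtain ⟨rfl, h⟩ := Sigma.mk.inj_iff.1 (eq_of_heq h)
      obtain ⟨rfl, rfl⟩ := (isPathIdeal_reduciblePaths hr φ).comp_inj
        (fun p hp => hv.mem_of_pos rfl rfl p hp) hp' hp (eq_of_heq h)
      simp
    · rw [if_neg h]
      split_ifs with h1 h2
      · exfalso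
        obtain ⟨rfl, h2⟩ := Sigma.mk.inj_iff.1 h2
        obtain ⟨-, h2⟩ := Sigma.mk.inj_iff.1 (eq_of_heq h2)
        obtain ⟨-, h1⟩ := Sigma.mk.inj_iff.1 h1
        obtain ⟨rfl, h1⟩ := Sigma.mk.inj_iff.1 (eq_of_heq h1)
        exact h (by rw [eq_of_heq h2, eq_of_heq h1])
      · rfl
      · rfl

/-- The combinatorial condition at a vertex `v` makes the ideal generated by `v` heredity: as a
left module it is the direct sum of the `R v q`, over the irreducible paths `q` starting at `v`. -/
theorem isHeredityIdeal_vertexIdeal (hr : IsAdmissibleOrder r) (hφ : Function.Surjective φ) {m : ℕ}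
    (hm : ∀ p : QuiverPath V, m ≤ p.2.2.length → φ (ofPath K p) = 0)
    (hv : IsHereditySet (reduciblePaths r φ) {v}) : IsHeredityIdeal (vertexIdeal φ {v}) := by
  have hL : vertexIdeal φ {v} = TwoSidedIdeal.span {φ (vertex K v)} := by
    rw [vertexIdeal, Set.image_singleton]
  have he : φ (vertex K v) * φ (vertex K v) = φ (vertex K v) := by rw [← map_mul, vertex_mul_self]
  refine ⟨?_, ?_, Or.inl ?_⟩
  · rw [hL]
    exact span_singleton_mul_self he
  · rw [hL]
    refine span_singleton_mul_mul_eq_bot fun j hj => ?_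
    obtain ⟨c, hc⟩ := exists_map_vertex_mul_mul_vertex hφ (map_cycle_eq_zero hr hφ hm hv) j
    rw [vertex_mul_self] at hc
    rw [hc]
    by_cases h0 : c = 0
    · rw [h0, zero_smul, map_zero]
    · have h1 : φ (vertex K v) = φ (algebraMap K _ c⁻¹) * φ (c • vertex K v) := by
        rw [← map_smul_eq, smul_smul, inv_mul_cancel₀ h0, one_smul]
      rw [map_smul_eq, eq_zero_of_mem_jacobson_of_mul_self he, mul_zero]
      rw [h1, ← hc]
      exact Ideal.mul_mem_left _ _ (Ideal.mul_mem_right _ _ (Ideal.mul_mem_left _ _ hj))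
  · refine projective_of_direct_sum he (ι := {q : QuiverPath V // q ∉ reduciblePaths r φ ∧ q.1 = v})
      (b := fun q => φ (ofPath K q.1)) ?_ ?_ ?_ ?_
    · rintro ⟨⟨_, b, q⟩, hq, rfl⟩
      rw [← map_mul, vertex_mul_ofPath]
    · rintro ⟨⟨_, b, q⟩, hq, rfl⟩
      rw [← vertex_mul_ofPath, map_mul]
      exact TwoSidedIdeal.mul_mem_right _ _ _ (map_vertex_mem_vertexIdeal φ rfl)
    · intro x hx
      obtain ⟨z, hz, rfl⟩ := (mem_vertexIdeal_iff hφ).1 hx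
      refine map_mem_of_mem_pathSpan φ ?_ hz
      rintro ⟨a, b, p⟩ ⟨v, rfl, s, t, e⟩
      dsimp only at s t e
      rw [e, ← ofPath_mul_comp, map_mul]
      refine Ideal.mul_mem_left _ _ ?_
      obtain ⟨y, hy, e⟩ := exists_normalForm hr φ ⟨v, b, t⟩
      rw [e]
      refine map_mem_of_mem_pathSpan φ ?_ hy
      rintro q ⟨hq, hq', -⟩
      exact Ideal.subset_span ⟨⟨q, hq, hq'⟩, rfl⟩
    · intro f hf hsum
      have h1 : ∀ i, ∃ y ∈ pathSpan K {p : QuiverPath V | p ∉ reduciblePaths r φ ∧ p.2.1 = v},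
          f i = φ y := by
        intro i
        obtain ⟨x, hx⟩ := hφ (f i)
        rw [← hf, ← hx, ← map_mul]
        refine exists_mem_pathSpan_map_eq φ ?_ (mul_vertex_mem_pathSpan (pathSpan_univ x) v)
        rintro p ⟨-, rfl⟩
        obtain ⟨y, hy, e⟩ := exists_normalForm hr φ p
        refine ⟨y, pathSpan_mono ?_ hy, e⟩
        rintro q ⟨h1, -, h2⟩
        exact ⟨h1, h2⟩
      choose y hy hfy using h1
      -- lifted to irreducible paths, the relation holds in the path algebra itself
      have h2 : ∑ i ∈ f.support, y i * ofPath K i.1 = 0 := by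
        refine eq_zero_of_mem_pathSpan_irreducible hr (φ := φ) (sum_mem fun i _ => ?_) ?_
        · refine mul_mem_pathSpan ?_ (hy i) (ofPath_mem_pathSpan (Set.mem_singleton _))
          rintro a b c p q ⟨hp, rfl⟩ hq
          rw [Set.mem_singleton_iff] at hq
          refine hv.comp_notMem rfl p q hp ?_
          rw [hq]
          exact i.2.1
        · rw [map_sum, ← hsum]
          exact Finset.sum_congr rfl fun i _ => by rw [map_mul, hfy]
      ext i
      by_contra hi
      have hyi : y i ≠ 0 := fun h => hi (by rw [hfy, h, map_zero]; rfl)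
      obtain ⟨p, hp, -⟩ := exists_isTip hr hyi
      have hp' := mem_pathSpan_iff.1 (hy i) p hp
      obtain ⟨⟨_, b, q⟩, hq, rfl⟩ := i
      obtain ⟨a, _, p⟩ := p
      obtain ⟨hp', rfl⟩ := hp'
      dsimp only at *
      refine hp ?_
      rw [← coeff_zero (K := K) ⟨a, b, p.comp q⟩, ← h2, coeff_sum]
      rw [Finset.sum_eq_single (⟨⟨_, b, q⟩, hq, rfl⟩ : {q : QuiverPath V // _}),
        coeff_mul_ofPath_irreducible hr hv (hy _) hp', if_pos rfl]
      · rintro ⟨⟨_, b', q'⟩, hq', h⟩ - hne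
        dsimp only at h
        subst h
        rw [coeff_mul_ofPath_irreducible hr hv (hy _) hp', if_neg]
        exact fun h => hne (Subtype.ext h)
      · exact fun h => absurd (Finsupp.mem_support_iff.2 hi) h

/-- Killing a vertex that satisfies the combinatorial condition adds exactly the paths through it
to the reducible paths. -/
theorem reduciblePaths_of_ker_vertexIdeal (hr : IsAdmissibleOrder r) (hφ : Function.Surjective φ)
    (hv : IsHereditySet (reduciblePaths r φ) {v}) {R' : Type*} [Ring R']
    {φ' : PathAlgebra K V →+* R'} (hφ' : ∀ x, φ' x = 0 ↔ φ x ∈ vertexIdeal φ {v}) :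
    reduciblePaths r φ' = reduciblePaths r φ ∪ pathsThrough {v} := by
  have := hr.isWellOrder
  apply Set.Subset.antisymm
  · intro p hp
    by_contra hp'
    rw [Set.mem_union, not_or] at hp'
    obtain ⟨x, hx, hpx⟩ := (mem_reduciblePaths_iff_exists_isTip hr φ' p).1 hp
    obtain ⟨z', hz', e'⟩ := (mem_vertexIdeal_iff hφ).1 ((hφ' x).1 hx)
    obtain ⟨z, hz, e⟩ : ∃ z ∈ pathSpan K ((reduciblePaths r φ)ᶜ ∩ pathsThrough {v}),
        φ z' = φ z := by
      refine exists_mem_pathSpan_map_eq φ ?_ hz'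
      rintro ⟨a, b, q⟩ ⟨v, rfl, s, t, e⟩
      dsimp only at s t e
      obtain ⟨ys, hys, es⟩ := exists_normalForm hr φ ⟨a, v, s⟩
      obtain ⟨yt, hyt, et⟩ := exists_normalForm hr φ ⟨v, b, t⟩
      refine ⟨ys * yt, mul_mem_pathSpan ?_ hys hyt, by
        rw [e, ← ofPath_mul_comp, map_mul, map_mul, es, et]⟩
      rintro a' b' c' s' t' ⟨hs, rfl, rfl⟩ ⟨ht, -, -⟩
      exact ⟨hv.comp_notMem rfl s' t' hs ht, comp_mem_pathsThrough (Set.mem_singleton _) s' t'⟩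
    -- `x - z` lies in the kernel of `φ`; its tip is reducible, so it does not occur in `z`, and it
    -- has to be the tip `p` of `x`
    have hz1 := mem_pathSpan_iff.1 hz
    have hzp : z.coeff p = 0 := by_contra fun h => hp'.2 (hz1 p h).2
    have hxzp : (x - z).coeff p ≠ 0 := by
      rw [coeff_sub, hzp, sub_zero]
      exact hpx.1
    obtain ⟨p', hp1, hp2⟩ := exists_isTip hr (x := x - z) fun h => hxzp (by rw [h, coeff_zero])
    have hp3 : p' ∈ reduciblePaths r φ := (mem_reduciblePaths_iff_exists_isTip hr φ p').2
      ⟨x - z, by rw [map_sub, ← e', e, sub_self], hp1, hp2⟩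
    have hzp' : z.coeff p' = 0 := by_contra fun h => (hz1 p' h).1 hp3
    rw [coeff_sub, hzp', sub_zero] at hp1
    rcases hpx.2 p' hp1 with rfl | h
    · exact hp'.1 hp3
    · rcases hp2 p hxzp with rfl | h'
      · exact hp'.1 hp3
      · exact asymm h h'
  · rintro p (hp | hp)
    · obtain ⟨x, hx, hp⟩ := (mem_reduciblePaths_iff_exists_isTip hr φ p).1 hp
      exact (mem_reduciblePaths_iff_exists_isTip hr φ' p).2
        ⟨x, (hφ' x).2 (by rw [hx]; exact zero_mem _), hp⟩
    · refine ⟨0, zero_mem _, ?_⟩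
      rw [map_zero, hφ', mem_vertexIdeal_iff hφ]
      exact ⟨_, ofPath_mem_pathSpan hp, rfl⟩

end HeredityVertex

/-! ### Projective modules and the radical -/

section Projective

/-- Annihilators of generators of a projective module. Let `b i = e i • b i` be generators, and
suppose that `b i₀` has only one expression in them whose coefficients lie in `e i₀ * A * e i`. By
splitting the presentation given by the generators one sees that `a • b i₀ = 0` only if
`a * e i₀ = 0`. -/
theorem mul_eq_zero_of_projective {A M : Type*} [Ring A] [AddCommGroup M] [Module A M]
    [Module.Projective A M] {ι : Type*} {b : ι → M} {e : ι → A}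
    (hspan : ∀ x : M, x ∈ Submodule.span A (Set.range b)) (he : ∀ i, e i * e i = e i)
    (heb : ∀ i, e i • b i = b i) (i₀ : ι)
    (hind : ∀ f : ι →₀ A, (∀ i, e i₀ * f i * e i = f i) → (f.sum fun i a => a • b i) = b i₀ →
      f i₀ = e i₀) {a : A} (ha : a • b i₀ = 0) : a * e i₀ = 0 := by
  have hsurj : Function.Surjective (Finsupp.linearCombination A b) := fun x =>
    Finsupp.mem_span_range_iff_exists_finsupp.1 (hspan x)
  obtain ⟨s, hs⟩ := Module.projective_lifting_property (Finsupp.linearCombination A b)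
    LinearMap.id hsurj
  have hs' : Finsupp.linearCombination A b (s (b i₀)) = b i₀ := LinearMap.congr_fun hs (b i₀)
  have hse : ∀ i, s (b i₀) i = e i₀ * s (b i₀) i := by
    intro i
    conv_lhs => rw [← heb i₀, map_smul]
    rfl
  -- `f` is the expression `s (b i₀)` with its coefficients cut down to `e i₀ * A * e i`
  let f : ι →₀ A := Finsupp.onFinset (s (b i₀)).support (fun i => s (b i₀) i * e i) (by
    intro i hi
    rw [Finsupp.mem_support_iff]
    intro h
    exact hi (by rw [h, zero_mul]))
  have hf : ∀ i, f i = s (b i₀) i * e i := fun i => rfl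
  have h1 : f i₀ = e i₀ := by
    refine hind f (fun i => ?_) ?_
    · rw [hf, mul_assoc, mul_assoc, he, ← mul_assoc, ← hse]
    · conv_rhs => rw [← hs', Finsupp.linearCombination_apply]
      rw [Finsupp.onFinset_sum _ (fun i => zero_smul A (b i))]
      exact Finset.sum_congr rfl fun i _ => by rw [mul_smul, heb]
  have h2 : a * s (b i₀) i₀ = 0 := by
    have : s (a • b i₀) i₀ = 0 := by rw [ha, map_zero]; rfl
    rwa [map_smul] at this
  rw [← h1, hf, ← mul_assoc, h2, zero_mul]

/-- If `e + j = (1 + j) * e` with `j` in the radical, `1 + j` can be cancelled. -/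
theorem mem_of_add_mem_of_mem_jacobson {R : Type*} [Ring R] {L : TwoSidedIdeal R} {e j : R}
    (hj : j ∈ Ring.jacobson R) (hje : j * e = j) (h : e + j ∈ L) : e ∈ L := by
  rw [← Ideal.jacobson_bot, Ideal.mem_jacobson_iff] at hj
  obtain ⟨z, hz⟩ := hj 1
  rw [Ideal.mem_bot, mul_one] at hz
  have h1 : z * (e + j) = e := by
    have h2 : (z * j + z - 1) * e = 0 := by rw [hz, zero_mul]
    rw [sub_mul, add_mul, mul_assoc, hje, one_mul, sub_eq_zero] at h2
    rw [mul_add, add_comm, h2]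
  rw [← h1]
  exact TwoSidedIdeal.mul_mem_left _ _ _ h

end Projective

/-! ### Heredity ideals of monomial algebras -/

section Monomial

variable {K : Type u} {V : Type v} [Quiver.{w} V] [Field K] [Fintype V] {R : Type*} [Ring R]
  {φ : PathAlgebra K V →+* R} {S : Set (QuiverPath V)} {L : TwoSidedIdeal R}

/-- A two-sided ideal contains every vertex `v` that occurs in one of its elements: by cutting the
element down at `v` on both sides and scaling, it contains `v + j` for some `j` in the radical. -/
theorem mem_pathSpan_of_map_mem (hφ : Function.Surjective φ) {m : ℕ}
    (hm : ∀ p : QuiverPath V, m ≤ p.2.2.length → φ (ofPath K p) = 0) {y : PathAlgebra K V}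
    (hy : φ y ∈ L) :
    y ∈ pathSpan K {p | 1 ≤ p.2.2.length ∨ p ∈ pathsThrough {v | φ (vertex K v) ∈ L}} := by
  rw [mem_pathSpan_iff]
  rintro ⟨a, b, p⟩ hp
  rcases Nat.eq_zero_or_pos p.length with h0 | h0
  swap
  · exact Or.inl h0
  obtain rfl := Quiver.Path.eq_of_length_zero p h0
  obtain rfl := Quiver.Path.eq_nil_of_length_zero p h0
  refine Or.inr ⟨a, ?_, Quiver.Path.nil, Quiver.Path.nil, rfl⟩
  set c := y.coeff ⟨a, a, Quiver.Path.nil⟩ with hc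
  set y' := y - c • vertex K a with hy'
  have h1 : y' ∈ pathSpan K {p : QuiverPath V | p ≠ ⟨a, a, Quiver.Path.nil⟩} := by
    refine mem_pathSpan_iff.2 ?_
    rintro q hq rfl
    simp [hy', vertex, coeff_ofPath, ← hc] at hq
  have h2 := mul_vertex_mem_pathSpan (vertex_mul_mem_pathSpan h1 a) a
  set n := vertex K a * y' * vertex K a with hn
  have h3 : φ n ∈ Ring.jacobson R := by
    refine map_mem_of_mem_pathSpan φ ?_ h2
    rintro ⟨s, t, q⟩ ⟨⟨hq, h4⟩, h5⟩
    dsimp only at h4 h5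
    subst h4 h5
    refine map_ofPath_mem_jacobson hφ hm (Nat.pos_of_ne_zero fun h => hq ?_)
    dsimp only at h
    rw [Quiver.Path.eq_nil_of_length_zero q h]
  have h4 : vertex K a * y * vertex K a = c • vertex K a + n := by
    rw [hn, hy', mul_sub, sub_mul, mul_smul_comm, smul_mul_assoc, vertex_mul_self, vertex_mul_self]
    abel
  refine mem_of_add_mem_of_mem_jacobson (j := φ (c⁻¹ • n)) ?_ ?_ ?_
  · rw [map_smul_eq]
    exact Ideal.mul_mem_left _ _ h3
  · rw [← map_mul, smul_mul_assoc, hn, mul_assoc, vertex_mul_self]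
  · have h5 : vertex K a + c⁻¹ • n = c⁻¹ • (vertex K a * y * vertex K a) := by
      rw [h4, smul_add, smul_smul, inv_mul_cancel₀ hp, one_smul]
    rw [← map_add, h5, map_smul_eq, map_mul, map_mul]
    exact TwoSidedIdeal.mul_mem_left _ _ _ (TwoSidedIdeal.mul_mem_right _ _ _
      (TwoSidedIdeal.mul_mem_left _ _ _ hy))

/-- An idempotent ideal is generated by the vertices it contains: modulo these, it is contained in
all powers of the nilpotent ideal generated by the arrows. -/
theorem eq_vertexIdeal_of_mul_self (hφ : Function.Surjective φ) {m : ℕ}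
    (hm : ∀ p : QuiverPath V, m ≤ p.2.2.length → φ (ofPath K p) = 0)
    (hL : L.asIdeal * L.asIdeal = L.asIdeal) : L = vertexIdeal φ {v | φ (vertex K v) ∈ L} := by
  apply le_antisymm
  · have key : ∀ k : ℕ, ∀ x ∈ L.asIdeal, ∃ y ∈ pathSpan K {p | k ≤ p.2.2.length ∨
        p ∈ pathsThrough {v | φ (vertex K v) ∈ L}}, φ y = x := by
      intro k
      induction k with
      | zero =>
        intro x _
        obtain ⟨y, rfl⟩ := hφ x
        refine ⟨y, pathSpan_mono ?_ (pathSpan_univ y), rfl⟩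
        exact fun p _ => Or.inl (Nat.zero_le _)
      | succ k ih =>
        intro x hx
        rw [← hL] at hx
        induction hx using Submodule.mul_induction_on' with
        | mem_mul_mem x hx x' hx' =>
          obtain ⟨y, rfl⟩ := hφ x
          obtain ⟨y', hy', rfl⟩ := ih x' hx'
          refine ⟨y * y', mul_mem_pathSpan ?_ (mem_pathSpan_of_map_mem hφ hm hx) hy',
            map_mul φ _ _⟩
          rintro a b c p q (hp | hp) (hq | hq)
          · refine Or.inl ?_
            dsimp only at hp hq ⊢
            rw [Quiver.Path.length_comp]
            omega
          · exact Or.inr ((comp_mem_pathsThrough_iff p q).2 (Or.inr hq))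
          · exact Or.inr ((comp_mem_pathsThrough_iff p q).2 (Or.inl hp))
          · exact Or.inr ((comp_mem_pathsThrough_iff p q).2 (Or.inl hp))
        | add x _ x' _ hx hx' =>
          obtain ⟨y, hy, rfl⟩ := hx
          obtain ⟨y', hy', rfl⟩ := hx'
          exact ⟨y + y', add_mem hy hy', map_add φ _ _⟩
    intro x hx
    obtain ⟨y, hy, rfl⟩ := key m x hx
    refine map_mem_of_mem_pathSpan φ (N := (vertexIdeal φ _).asIdeal) ?_ hy
    rintro p (hp | hp)
    · rw [hm p hp]
      exact zero_mem _
    · exact (mem_vertexIdeal_iff hφ).2 ⟨_, ofPath_mem_pathSpan hp, rfl⟩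
  · rw [vertexIdeal, TwoSidedIdeal.span_le]
    rintro _ ⟨v, hv, rfl⟩
    exact hv

theorem map_ofPath_eq_zero_of_heredity (hφ : Function.Surjective φ) {m : ℕ}
    (hm : ∀ p : QuiverPath V, m ≤ p.2.2.length → φ (ofPath K p) = 0) (hL : IsHeredityIdeal L)
    {a b : V} (ha : φ (vertex K a) ∈ L) (hb : φ (vertex K b) ∈ L) (p : Quiver.Path a b)
    (hp : 0 < p.length) : φ (ofPath K ⟨a, b, p⟩) = 0 := by
  rw [← Ideal.mem_bot, ← hL.mul_jacobson_mul, ← vertex_mul_ofPath, ← ofPath_mul_vertex,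
    ← mul_assoc, map_mul, map_mul]
  exact Ideal.mul_mem_mul (Ideal.mul_mem_mul ha (map_ofPath_mem_jacobson hφ hm hp)) hb

/-- Over a monomial algebra, projectivity of a heredity ideal on the left forces the composites of
paths outside `S` at its vertices to be outside `S`. -/
theorem comp_notMem_of_projective_left (hφ : Function.Surjective φ)
    (hker : ∀ x, φ x = 0 ↔ x ∈ pathSpan K S) {W : Set V} (hL : L = vertexIdeal φ W)
    (hpos : ∀ ⦃a b : V⦄, a ∈ W → b ∈ W → ∀ p : Quiver.Path a b, 0 < p.length →
      φ (ofPath K ⟨a, b, p⟩) = 0) (hproj : Module.Projective R L) {a b c : V} (hb : b ∈ W)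
    (p : Quiver.Path a b) (q : Quiver.Path b c) (hp : (⟨a, b, p⟩ : QuiverPath V) ∉ S)
    (hq : (⟨b, c, q⟩ : QuiverPath V) ∉ S) : (⟨a, c, p.comp q⟩ : QuiverPath V) ∉ S := by
  have hL' : ∀ q : QuiverPath V, q.1 ∈ W → φ (ofPath K q) ∈ L := by
    rintro ⟨a, b, q⟩ h
    rw [hL, ← vertex_mul_ofPath, map_mul]
    exact TwoSidedIdeal.mul_mem_right _ _ _ (map_vertex_mem_vertexIdeal φ h)
  let gen : {q : QuiverPath V // q ∉ S ∧ q.1 ∈ W} → L := fun q => ⟨φ (ofPath K q.1), hL' _ q.2.2⟩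
  have hspan : ∀ z ∈ pathSpan K (pathsThrough W), ∃ y ∈ Submodule.span R (Set.range gen),
      (y : R) = φ z := by
    intro z hz
    induction hz using Submodule.span_induction with
    | zero => exact ⟨0, zero_mem _, (map_zero φ).symm⟩
    | add x x' _ _ hx hx' =>
      obtain ⟨y, hy, e⟩ := hx
      obtain ⟨y', hy', e'⟩ := hx'
      exact ⟨y + y', add_mem hy hy', by rw [map_add, ← e, ← e']; rfl⟩
    | smul k x _ hx =>
      obtain ⟨y, hy, e⟩ := hx
      exact ⟨φ (algebraMap K _ k) • y, Submodule.smul_mem _ _ hy, by rw [map_smul_eq, ← e]; rfl⟩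
    | mem x hx =>
      obtain ⟨⟨a, b, p⟩, ⟨w, hw, s, t, e⟩, rfl⟩ := hx
      dsimp only at s t e
      rw [e, ← ofPath_mul_comp, map_mul]
      by_cases ht : (⟨w, b, t⟩ : QuiverPath V) ∈ S
      · exact ⟨0, zero_mem _, by rw [(hker _).2 (ofPath_mem_pathSpan ht), mul_zero]; rfl⟩
      · exact ⟨φ (ofPath K ⟨a, w, s⟩) • gen ⟨⟨w, b, t⟩, ht, hw⟩,
          Submodule.smul_mem _ _ (Submodule.subset_span ⟨_, rfl⟩), rfl⟩
  intro hpq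
  have hzero : φ (ofPath K ⟨a, b, p⟩) * φ (vertex K b) = 0 := by
    refine mul_eq_zero_of_projective (b := gen) (e := fun q => φ (vertex K q.1.1)) ?_ ?_ ?_
      ⟨⟨b, c, q⟩, hq, hb⟩ ?_ ?_
    · rintro ⟨x, hx⟩
      obtain ⟨z, hz, rfl⟩ := (mem_vertexIdeal_iff hφ).1 (hL ▸ hx)
      obtain ⟨y, hy, e⟩ := hspan z hz
      rwa [← show y = ⟨φ z, hx⟩ from Subtype.ext e]
    · exact fun q => by rw [← map_mul, vertex_mul_self]
    · rintro ⟨⟨a, b, q⟩, hq, h⟩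
      refine Subtype.ext ?_
      change φ (vertex K a) * φ (ofPath K ⟨a, b, q⟩) = φ (ofPath K ⟨a, b, q⟩)
      rw [← map_mul, vertex_mul_ofPath]
    · intro f hf hsum
      dsimp only at hf ⊢
      have h1 : ∀ i, ∃ k : K, f i = φ (k • (vertex K b * vertex K i.1.1)) := by
        intro i
        obtain ⟨k, hk⟩ := exists_map_vertex_mul_mul_vertex hφ (hpos hb i.2.2) (f i)
        exact ⟨k, by rw [← hf, hk]⟩
      choose k hk using h1
      -- this is a relation between paths outside `S`, so the coefficients can be compared
      have h2 : ∑ i ∈ f.support, k i • (vertex K b * vertex K i.1.1 * ofPath K i.1) -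
          ofPath K ⟨b, c, q⟩ ∈ pathSpan K S := by
        rw [← hker, map_sub, sub_eq_zero]
        refine Eq.trans ?_ (congrArg Subtype.val hsum)
        rw [map_sum]
        refine Eq.trans ?_ (map_sum (TwoSidedIdeal.subtype L) _ _).symm
        refine Finset.sum_congr rfl fun i _ => ?_
        rw [← smul_mul_assoc, map_mul, ← hk]
        rfl
      have h3 := by_contra fun h => hq (mem_pathSpan_iff.1 h2 ⟨b, c, q⟩ h)
      rw [coeff_sub, coeff_sum, Finset.sum_eq_single ⟨⟨b, c, q⟩, hq, hb⟩] at h3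
      · rw [vertex_mul_self, vertex_mul_ofPath, coeff_smul, coeff_ofPath, if_pos rfl, mul_one,
          sub_eq_zero] at h3
        rw [hk, h3, one_smul, vertex_mul_self]
      · rintro ⟨⟨w, d, q'⟩, hq', hw⟩ - hne
        by_cases h : b = w
        · subst h
          rw [vertex_mul_self, vertex_mul_ofPath, coeff_smul, coeff_ofPath, if_neg, mul_zero]
          exact fun h => hne (Subtype.ext h)
        · rw [vertex_mul_vertex_of_ne h, zero_mul, smul_zero, coeff_zero]
      · intro h
        rw [coeff_smul, vertex_mul_self, vertex_mul_ofPath]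
        have h4 : φ (k ⟨⟨b, c, q⟩, hq, hb⟩ • ofPath K ⟨b, c, q⟩) = 0 := by
          rw [← vertex_mul_ofPath, ← vertex_mul_self, ← smul_mul_assoc, map_mul, ← hk,
            Finsupp.notMem_support_iff.1 h, zero_mul]
        have h5 := by_contra fun h => hq (mem_pathSpan_iff.1 ((hker _).1 h4) ⟨b, c, q⟩ h)
        rwa [coeff_smul] at h5
    · refine Subtype.ext ?_
      change φ (ofPath K ⟨a, b, p⟩) * φ (ofPath K ⟨b, c, q⟩) = 0
      rw [← map_mul, ofPath_mul_comp, hker]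
      exact ofPath_mem_pathSpan hpq
  rw [← map_mul, ofPath_mul_vertex, hker] at hzero
  exact hp (ofPath_mem_pathSpan_iff.1 hzero)

/-- The right-handed version of `comp_notMem_of_projective_left`. -/
theorem comp_notMem_of_projective_right (hφ : Function.Surjective φ)
    (hker : ∀ x, φ x = 0 ↔ x ∈ pathSpan K S) {W : Set V} (hL : L = vertexIdeal φ W)
    (hpos : ∀ ⦃a b : V⦄, a ∈ W → b ∈ W → ∀ p : Quiver.Path a b, 0 < p.length →
      φ (ofPath K ⟨a, b, p⟩) = 0) (hproj : Module.Projective Rᵐᵒᵖ L) {a b c : V} (hb : b ∈ W)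
    (p : Quiver.Path a b) (q : Quiver.Path b c) (hp : (⟨a, b, p⟩ : QuiverPath V) ∉ S)
    (hq : (⟨b, c, q⟩ : QuiverPath V) ∉ S) : (⟨a, c, p.comp q⟩ : QuiverPath V) ∉ S := by
  have hL' : ∀ q : QuiverPath V, q.2.1 ∈ W → φ (ofPath K q) ∈ L := by
    rintro ⟨a, b, q⟩ h
    rw [hL, ← ofPath_mul_vertex, map_mul]
    exact TwoSidedIdeal.mul_mem_left _ _ _ (map_vertex_mem_vertexIdeal φ h)
  let gen : {q : QuiverPath V // q ∉ S ∧ q.2.1 ∈ W} → L := fun q => ⟨φ (ofPath K q.1), hL' _ q.2.2⟩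
  have hspan : ∀ z ∈ pathSpan K (pathsThrough W), ∃ y ∈ Submodule.span Rᵐᵒᵖ (Set.range gen),
      (y : R) = φ z := by
    intro z hz
    induction hz using Submodule.span_induction with
    | zero => exact ⟨0, zero_mem _, (map_zero φ).symm⟩
    | add x x' _ _ hx hx' =>
      obtain ⟨y, hy, e⟩ := hx
      obtain ⟨y', hy', e'⟩ := hx'
      exact ⟨y + y', add_mem hy hy', by rw [map_add, ← e, ← e']; rfl⟩
    | smul k x _ hx =>
      obtain ⟨y, hy, e⟩ := hx
      refine ⟨MulOpposite.op (φ (algebraMap K _ k)) • y, Submodule.smul_mem _ _ hy, ?_⟩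
      rw [Algebra.smul_def, Algebra.commutes, map_mul, ← e]
      rfl
    | mem x hx =>
      obtain ⟨⟨a, b, p⟩, ⟨w, hw, s, t, e⟩, rfl⟩ := hx
      dsimp only at s t e
      rw [e, ← ofPath_mul_comp, map_mul]
      by_cases hs : (⟨a, w, s⟩ : QuiverPath V) ∈ S
      · exact ⟨0, zero_mem _, by rw [(hker _).2 (ofPath_mem_pathSpan hs), zero_mul]; rfl⟩
      · exact ⟨MulOpposite.op (φ (ofPath K ⟨w, b, t⟩)) • gen ⟨⟨a, w, s⟩, hs, hw⟩,
          Submodule.smul_mem _ _ (Submodule.subset_span ⟨_, rfl⟩), rfl⟩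
  intro hpq
  have hzero : MulOpposite.op (φ (ofPath K ⟨b, c, q⟩)) * MulOpposite.op (φ (vertex K b)) = 0 := by
    refine mul_eq_zero_of_projective (b := gen)
      (e := fun q => MulOpposite.op (φ (vertex K q.1.2.1))) ?_ ?_ ?_ ⟨⟨a, b, p⟩, hp, hb⟩ ?_ ?_
    · rintro ⟨x, hx⟩
      obtain ⟨z, hz, rfl⟩ := (mem_vertexIdeal_iff hφ).1 (hL ▸ hx)
      obtain ⟨y, hy, e⟩ := hspan z hz
      rwa [← show y = ⟨φ z, hx⟩ from Subtype.ext e]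
    · exact fun q => by rw [← MulOpposite.op_mul, ← map_mul, vertex_mul_self]
    · rintro ⟨⟨a, b, q⟩, hq, h⟩
      refine Subtype.ext ?_
      change φ (ofPath K ⟨a, b, q⟩) * φ (vertex K b) = φ (ofPath K ⟨a, b, q⟩)
      rw [← map_mul, ofPath_mul_vertex]
    · intro f hf hsum
      dsimp only at hf ⊢
      have h1 : ∀ i, ∃ k : K,
          f i = MulOpposite.op (φ (k • (vertex K i.1.2.1 * vertex K b))) := by
        intro i
        obtain ⟨k, hk⟩ := exists_map_vertex_mul_mul_vertex hφ (hpos i.2.2 hb) (f i).unop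
        refine ⟨k, MulOpposite.unop_injective ?_⟩
        rw [← hf, MulOpposite.unop_op, ← hk]
        simp [mul_assoc]
      choose k hk using h1
      -- this is a relation between paths outside `S`, so the coefficients can be compared
      have h2 : ∑ i ∈ f.support, k i • (ofPath K i.1 * (vertex K i.1.2.1 * vertex K b)) -
          ofPath K ⟨a, b, p⟩ ∈ pathSpan K S := by
        rw [← hker, map_sub, sub_eq_zero]
        refine Eq.trans ?_ (congrArg Subtype.val hsum)
        rw [map_sum]
        refine Eq.trans ?_ (map_sum (TwoSidedIdeal.subtype L) _ _).symm
        refine Finset.sum_congr rfl fun i _ => ?_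
        rw [← mul_smul_comm, map_mul, hk]
        rfl
      have h3 := by_contra fun h => hp (mem_pathSpan_iff.1 h2 ⟨a, b, p⟩ h)
      rw [coeff_sub, coeff_sum, Finset.sum_eq_single ⟨⟨a, b, p⟩, hp, hb⟩] at h3
      · rw [vertex_mul_self, ofPath_mul_vertex, coeff_smul, coeff_ofPath, if_pos rfl, mul_one,
          sub_eq_zero] at h3
        rw [hk, h3, one_smul, vertex_mul_self]
      · rintro ⟨⟨d, w, q'⟩, hq', hw⟩ - hne
        by_cases h : w = b
        · subst h
          rw [vertex_mul_self, ofPath_mul_vertex, coeff_smul, coeff_ofPath, if_neg, mul_zero]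
          exact fun h => hne (Subtype.ext h)
        · rw [vertex_mul_vertex_of_ne h, mul_zero, smul_zero, coeff_zero]
      · intro h
        rw [coeff_smul, vertex_mul_self, ofPath_mul_vertex]
        have h4 : φ (k ⟨⟨a, b, p⟩, hp, hb⟩ • ofPath K ⟨a, b, p⟩) = 0 := by
          have h6 := hk ⟨⟨a, b, p⟩, hp, hb⟩
          rw [Finsupp.notMem_support_iff.1 h, vertex_mul_self] at h6
          rw [← ofPath_mul_vertex, ← mul_smul_comm, map_mul,
            (MulOpposite.op_eq_zero_iff _).1 h6.symm, mul_zero]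
        have h5 := by_contra fun h => hp (mem_pathSpan_iff.1 ((hker _).1 h4) ⟨a, b, p⟩ h)
        rwa [coeff_smul] at h5
    · refine Subtype.ext ?_
      change φ (ofPath K ⟨a, b, p⟩) * φ (ofPath K ⟨b, c, q⟩) = 0
      rw [← map_mul, ofPath_mul_comp, hker]
      exact ofPath_mem_pathSpan hpq
  rw [← MulOpposite.op_mul, MulOpposite.op_eq_zero_iff, ← map_mul, vertex_mul_ofPath, hker] at hzero
  exact hq (ofPath_mem_pathSpan_iff.1 hzero)

/-- The vertices in a heredity ideal of a monomial algebra satisfy the combinatorial condition. -/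
theorem isHereditySet_of_isHeredityIdeal (hφ : Function.Surjective φ)
    (hker : ∀ x, φ x = 0 ↔ x ∈ pathSpan K S) {m : ℕ}
    (hm : ∀ p : QuiverPath V, m ≤ p.2.2.length → φ (ofPath K p) = 0) (hL : IsHeredityIdeal L) :
    IsHereditySet S {v | φ (vertex K v) ∈ L} := by
  have hpos : ∀ ⦃a b : V⦄, a ∈ {v | φ (vertex K v) ∈ L} → b ∈ {v | φ (vertex K v) ∈ L} →
      ∀ p : Quiver.Path a b, 0 < p.length → φ (ofPath K ⟨a, b, p⟩) = 0 :=
    fun a b ha hb => map_ofPath_eq_zero_of_heredity hφ hm hL ha hb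
  have hL' := eq_vertexIdeal_of_mul_self hφ hm hL.mul_self
  refine ⟨fun a b ha hb p hp => ofPath_mem_pathSpan_iff.1 ((hker _).1 (hpos ha hb p hp)),
    fun a b c hb p q hp hq => ?_⟩
  rcases hL.projective with h | h
  · exact comp_notMem_of_projective_left hφ hker hL' hpos h hb p q hp hq
  · exact comp_notMem_of_projective_right hφ hker hL' hpos h hb p q hp hq

end Monomial

/-! ### Heredity chains -/

section Chains

/-- The first `i` vertices of an ordering. -/
def firstVertices {V : Type v} [Fintype V] (σ : Fin (Fintype.card V) ≃ V) (i : ℕ) : Set V :=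
  {v | (σ.symm v).val < i}

theorem firstVertices_succ {V : Type v} [Fintype V] (σ : Fin (Fintype.card V) ≃ V)
    (i : Fin (Fintype.card V)) :
    firstVertices σ (i + 1) = firstVertices σ i ∪ {σ i} := by
  ext v
  simp only [firstVertices, Set.mem_ofPred_eq, Set.mem_union, Set.mem_singleton_iff,
    ← Equiv.symm_apply_eq, Fin.ext_iff]
  omega

variable {K : Type u} {V : Type v} [Quiver.{w} V] [Field K] [Fintype V]

theorem TwoSidedIdeal.map_span {R R' : Type*} [Ring R] [Ring R'] (f : R →+* R') (s : Set R) :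
    (TwoSidedIdeal.span s).map f = TwoSidedIdeal.span (f '' s) := by
  apply le_antisymm
  · rw [TwoSidedIdeal.map, TwoSidedIdeal.span_le]
    rintro _ ⟨x, hx, rfl⟩
    have h : TwoSidedIdeal.span s ≤ (TwoSidedIdeal.span (f '' s)).comap f := by
      rw [TwoSidedIdeal.span_le]
      exact fun y hy => (TwoSidedIdeal.mem_comap f).2 (TwoSidedIdeal.subset_span ⟨y, hy, rfl⟩)
    exact (TwoSidedIdeal.mem_comap f).1 (h hx)
  · exact TwoSidedIdeal.span_mono (Set.image_mono TwoSidedIdeal.subset_span)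

theorem TwoSidedIdeal.mk_mem_map_mk_iff {R : Type*} [Ring R] {M M' : TwoSidedIdeal R}
    (h : M ≤ M') (x : R) :
    Ideal.Quotient.mk M.asIdeal x ∈ M'.map (Ideal.Quotient.mk M.asIdeal) ↔ x ∈ M' := by
  constructor
  · intro hx
    have key : ∀ z ∈ M'.map (Ideal.Quotient.mk M.asIdeal),
        ∃ y ∈ M', Ideal.Quotient.mk M.asIdeal y = z := by
      intro z hz
      induction hz using TwoSidedIdeal.span_induction with
      | mem z hz => exact hz
      | zero => exact ⟨0, M'.zero_mem, map_zero _⟩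
      | add z z' _ _ hz hz' =>
        obtain ⟨y, hy, rfl⟩ := hz
        obtain ⟨y', hy', rfl⟩ := hz'
        exact ⟨y + y', M'.add_mem hy hy', map_add _ _ _⟩
      | neg z _ hz =>
        obtain ⟨y, hy, rfl⟩ := hz
        exact ⟨-y, M'.neg_mem hy, map_neg _ _⟩
      | left_absorb a z _ hz =>
        obtain ⟨y, hy, rfl⟩ := hz
        obtain ⟨a, rfl⟩ := Ideal.Quotient.mk_surjective a
        exact ⟨a * y, TwoSidedIdeal.mul_mem_left _ _ _ hy, map_mul _ _ _⟩
      | right_absorb a z _ hz =>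
        obtain ⟨y, hy, rfl⟩ := hz
        obtain ⟨a, rfl⟩ := Ideal.Quotient.mk_surjective a
        exact ⟨y * a, TwoSidedIdeal.mul_mem_right _ _ _ hy, map_mul _ _ _⟩
    obtain ⟨y, hy, e⟩ := key _ hx
    rw [Ideal.Quotient.eq, TwoSidedIdeal.mem_asIdeal] at e
    have := M'.sub_mem hy (h e)
    rwa [sub_sub_cancel] at this
  · exact fun hx => TwoSidedIdeal.subset_span ⟨x, hx, rfl⟩

/-- The quotient map from the path algebra onto the quotient of `KQ/J` by an ideal `M`. -/
noncomputable def quotientMap (J : TwoSidedIdeal (PathAlgebra K V))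
    (M : TwoSidedIdeal (QuiverAlgebra J)) :
    PathAlgebra K V →+* QuiverAlgebra J ⧸ M.asIdeal :=
  (Ideal.Quotient.mk M.asIdeal).comp (Ideal.Quotient.mk J.asIdeal)

variable {J : TwoSidedIdeal (PathAlgebra K V)}

theorem quotientMap_surjective (M : TwoSidedIdeal (QuiverAlgebra J)) :
    Function.Surjective (quotientMap J M) :=
  Ideal.Quotient.mk_surjective.comp Ideal.Quotient.mk_surjective

theorem quotientMap_eq_zero_iff {M : TwoSidedIdeal (QuiverAlgebra J)} {x : PathAlgebra K V} :
    quotientMap J M x = 0 ↔ Ideal.Quotient.mk J.asIdeal x ∈ M :=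
  Ideal.Quotient.eq_zero_iff_mem

theorem quotientMap_mem_map_iff {M M' : TwoSidedIdeal (QuiverAlgebra J)} (h : M ≤ M')
    {x : PathAlgebra K V} : quotientMap J M x ∈ M'.map (Ideal.Quotient.mk M.asIdeal) ↔
      Ideal.Quotient.mk J.asIdeal x ∈ M' :=
  TwoSidedIdeal.mk_mem_map_mk_iff h _

theorem vertexIdeal_mono {R : Type*} [Ring R] (φ : PathAlgebra K V →+* R) {W W' : Set V}
    (h : W ⊆ W') : vertexIdeal φ W ≤ vertexIdeal φ W' :=
  TwoSidedIdeal.span_mono (Set.image_mono h)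

theorem map_vertexIdeal (M : TwoSidedIdeal (QuiverAlgebra J)) (W : Set V) :
    (vertexIdeal (Ideal.Quotient.mk J.asIdeal) W).map (Ideal.Quotient.mk M.asIdeal) =
      vertexIdeal (quotientMap J M) W := by
  rw [vertexIdeal, TwoSidedIdeal.map_span, Set.image_image]
  rfl

theorem vertexIdeal_union_eq {R : Type*} [Ring R] {φ : PathAlgebra K V →+* R} {U W : Set V}
    (h : ∀ u ∈ U, φ (vertex K u) = 0) : vertexIdeal φ (U ∪ W) = vertexIdeal φ W := by
  apply le_antisymm
  · rw [vertexIdeal, TwoSidedIdeal.span_le]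
    rintro _ ⟨u, hu | hu, rfl⟩
    · dsimp only
      rw [h u hu]
      exact zero_mem _
    · exact map_vertex_mem_vertexIdeal φ hu
  · exact vertexIdeal_mono φ Set.subset_union_right

theorem vertexChain_eq_vertexIdeal (J : TwoSidedIdeal (PathAlgebra K V))
    (σ : Fin (Fintype.card V) ≃ V) (i : ℕ) :
    vertexChain J σ i = vertexIdeal (Ideal.Quotient.mk J.asIdeal) (firstVertices σ i) := by
  apply le_antisymm
  · rw [vertexChain, TwoSidedIdeal.span_le, Set.singleton_subset_iff, map_sum]
    refine sum_mem fun j hj => map_vertex_mem_vertexIdeal _ ?_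
    rw [Finset.mem_filter] at hj
    simpa [firstVertices] using hj.2
  · rw [vertexIdeal, TwoSidedIdeal.span_le]
    rintro _ ⟨v, hv, rfl⟩
    have h : vertex K v = vertex K v *
        ∑ j : Fin (Fintype.card V) with j.val < i, vertex K (σ j) := by
      rw [Finset.mul_sum, Finset.sum_eq_single (σ.symm v), Equiv.apply_symm_apply, vertex_mul_self]
      · rintro j - hj
        exact vertex_mul_vertex_of_ne fun h => hj (by rw [h, Equiv.symm_apply_apply])
      · exact fun h => absurd (Finset.mem_filter.2 ⟨Finset.mem_univ (σ.symm v), hv⟩) h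
    dsimp only
    rw [h, map_mul]
    exact TwoSidedIdeal.mul_mem_left _ _ _ (TwoSidedIdeal.subset_span rfl)

theorem vertexChain_zero (σ : Fin (Fintype.card V) ≃ V) : vertexChain J σ 0 = ⊥ := by
  rw [vertexChain_eq_vertexIdeal, eq_bot_iff, vertexIdeal, TwoSidedIdeal.span_le]
  rintro _ ⟨v, hv, -⟩
  exact absurd hv (Nat.not_lt_zero _)

theorem vertexChain_card (σ : Fin (Fintype.card V) ≃ V) :
    vertexChain J σ (Fintype.card V) = ⊤ := by
  rw [vertexChain_eq_vertexIdeal, ← TwoSidedIdeal.one_mem_iff,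
    ← map_one (Ideal.Quotient.mk J.asIdeal), one_def, map_sum]
  exact sum_mem fun v _ => map_vertex_mem_vertexIdeal _ (σ.symm v).2

theorem vertexChain_mono (σ : Fin (Fintype.card V) ≃ V) : Monotone (vertexChain J σ) := by
  intro i j h
  rw [vertexChain_eq_vertexIdeal, vertexChain_eq_vertexIdeal]
  exact vertexIdeal_mono _ fun v hv => lt_of_lt_of_le hv h

variable {r : QuiverPath V → QuiverPath V → Prop}

/-- Along an ordering satisfying the combinatorial condition, the reducible paths grow in each step
by the paths through the new vertex. -/
theorem reduciblePaths_quotientMap_vertexChain (hr : IsAdmissibleOrder r)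
    {σ : Fin (Fintype.card V) ≃ V}
    (h : ∀ i : Fin (Fintype.card V),
      IsHereditySet (reduciblePaths r (Ideal.Quotient.mk J.asIdeal) ∪
        pathsThrough (firstVertices σ i)) {σ i})
    {i : ℕ} (hi : i ≤ Fintype.card V) :
    reduciblePaths r (quotientMap J (vertexChain J σ i)) =
      reduciblePaths r (Ideal.Quotient.mk J.asIdeal) ∪ pathsThrough (firstVertices σ i) := by
  induction i with
  | zero =>
    ext p
    have h0 : p ∉ pathsThrough (firstVertices σ 0) := by
      rintro ⟨w, hw, -⟩
      exact absurd hw (Nat.not_lt_zero _)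
    rw [Set.mem_union, or_iff_left h0, mem_reduciblePaths_iff_exists_isTip hr,
      mem_reduciblePaths_iff_exists_isTip hr]
    simp only [quotientMap_eq_zero_iff, vertexChain_zero, TwoSidedIdeal.mem_bot]
  | succ i ih =>
    have ih := ih (Nat.le_of_succ_le hi)
    let j : Fin (Fintype.card V) := ⟨i, hi⟩
    have hj := firstVertices_succ σ j
    have hv := h j
    rw [show ((j : Fin _) : ℕ) = i from rfl] at hj hv
    rw [reduciblePaths_of_ker_vertexIdeal hr (quotientMap_surjective (vertexChain J σ i))
      (v := σ j) (ih.symm ▸ hv), ih, Set.union_assoc, ← pathsThrough_union, hj]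
    intro x
    rw [quotientMap_eq_zero_iff, ← quotientMap_mem_map_iff (vertexChain_mono σ (Nat.le_succ i)),
      vertexChain_eq_vertexIdeal J σ (i + 1), map_vertexIdeal, hj, vertexIdeal_union_eq]
    intro u hu
    rw [quotientMap_eq_zero_iff, vertexChain_eq_vertexIdeal]
    exact map_vertex_mem_vertexIdeal _ hu

/-- The combinatorial criterion: if every vertex satisfies the condition relative to the reducible
paths and the paths through earlier vertices, the ordering gives a heredity chain. -/
theorem isHeredityChain_vertexChain (hr : IsAdmissibleOrder r) {m : ℕ}
    (hm : ∀ p : QuiverPath V, m ≤ p.2.2.length → Ideal.Quotient.mk J.asIdeal (ofPath K p) = 0)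
    {σ : Fin (Fintype.card V) ≃ V}
    (h : ∀ i : Fin (Fintype.card V),
      IsHereditySet (reduciblePaths r (Ideal.Quotient.mk J.asIdeal) ∪
        pathsThrough (firstVertices σ i)) {σ i}) :
    IsHeredityChain (Fintype.card V) (vertexChain J σ) where
  zero := vertexChain_zero σ
  last := vertexChain_card σ
  le_succ i _ := vertexChain_mono σ (Nat.le_succ i)
  heredity i hi := by
    have hj := firstVertices_succ σ ⟨i, hi⟩
    have hv := h ⟨i, hi⟩
    dsimp only at hj hv
    rw [← reduciblePaths_quotientMap_vertexChain hr h hi.le] at hv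
    rw [vertexChain_eq_vertexIdeal J σ (i + 1), map_vertexIdeal, hj, vertexIdeal_union_eq]
    · refine isHeredityIdeal_vertexIdeal hr (quotientMap_surjective _) (m := m) (fun p hp => ?_) hv
      rw [quotientMap_eq_zero_iff, hm p hp]
      exact zero_mem _
    · intro u hu
      rw [quotientMap_eq_zero_iff, vertexChain_eq_vertexIdeal]
      exact map_vertex_mem_vertexIdeal _ hu

theorem map_mem_vertexIdeal_iff_of_ker {R : Type*} [Ring R] {φ : PathAlgebra K V →+* R}
    (hφ : Function.Surjective φ) {S : Set (QuiverPath V)}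
    (hker : ∀ x, φ x = 0 ↔ x ∈ pathSpan K S) (W : Set V) (x : PathAlgebra K V) :
    φ x ∈ vertexIdeal φ W ↔ x ∈ pathSpan K (S ∪ pathsThrough W) := by
  rw [mem_vertexIdeal_iff hφ, pathSpan_union, Submodule.mem_sup]
  constructor
  · rintro ⟨z, hz, e⟩
    exact ⟨x - z, (hker _).1 (by rw [map_sub, e, sub_self]), z, hz, sub_add_cancel x z⟩
  · rintro ⟨y, hy, z, hz, rfl⟩
    exact ⟨z, hz, by rw [map_add, (hker y).2 hy, zero_add]⟩

variable {S : Set (QuiverPath V)}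

/-- The ideals of any heredity chain of a monomial algebra are spanned by paths: by `S` and the
paths through the vertices they contain. -/
theorem IsHeredityChain.mk_mem_iff
    (hker : ∀ x, Ideal.Quotient.mk J.asIdeal x = 0 ↔ x ∈ pathSpan K S) {m : ℕ}
    (hm : ∀ p : QuiverPath V, m ≤ p.2.2.length → Ideal.Quotient.mk J.asIdeal (ofPath K p) = 0)
    {n : ℕ} {L : ℕ → TwoSidedIdeal (QuiverAlgebra J)} (hL : IsHeredityChain n L) {i : ℕ}
    (hi : i ≤ n) (x : PathAlgebra K V) : Ideal.Quotient.mk J.asIdeal x ∈ L i ↔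
      x ∈ pathSpan K (S ∪ pathsThrough {v | Ideal.Quotient.mk J.asIdeal (vertex K v) ∈ L i}) := by
  induction i generalizing x with
  | zero =>
    rw [hL.zero, TwoSidedIdeal.mem_bot, ← map_mem_vertexIdeal_iff_of_ker
      Ideal.Quotient.mk_surjective hker, ← TwoSidedIdeal.mem_bot]
    suffices h : vertexIdeal (Ideal.Quotient.mk J.asIdeal)
        {v | Ideal.Quotient.mk J.asIdeal (vertex K v) ∈ (⊥ : TwoSidedIdeal (QuiverAlgebra J))} =
          ⊥ by rw [h]
    rw [eq_bot_iff, vertexIdeal, TwoSidedIdeal.span_le]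
    rintro _ ⟨v, hv, rfl⟩
    exact hv
  | succ i ih =>
    have ih := ih (Nat.le_of_succ_le hi)
    have hle := hL.le_succ i hi
    have hW : {v | Ideal.Quotient.mk J.asIdeal (vertex K v) ∈ L i} ⊆
        {v | Ideal.Quotient.mk J.asIdeal (vertex K v) ∈ L (i + 1)} := fun v hv => hle hv
    have hM := eq_vertexIdeal_of_mul_self (quotientMap_surjective (L i)) (m := m) (fun p hp => by
      rw [quotientMap_eq_zero_iff, hm p hp]
      exact zero_mem _) (hL.heredity i hi).mul_self
    simp only [quotientMap_mem_map_iff hle] at hM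
    rw [← quotientMap_mem_map_iff hle, hM, map_mem_vertexIdeal_iff_of_ker
      (quotientMap_surjective (L i)) (fun x => quotientMap_eq_zero_iff.trans (ih x)),
      Set.union_assoc, ← pathsThrough_union, Set.union_eq_right.2 hW]

/-- The combinatorial content of a heredity chain of a monomial algebra. -/
theorem IsHeredityChain.isHereditySet
    (hker : ∀ x, Ideal.Quotient.mk J.asIdeal x = 0 ↔ x ∈ pathSpan K S) {m : ℕ}
    (hm : ∀ p : QuiverPath V, m ≤ p.2.2.length → Ideal.Quotient.mk J.asIdeal (ofPath K p) = 0)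
    {n : ℕ} {L : ℕ → TwoSidedIdeal (QuiverAlgebra J)} (hL : IsHeredityChain n L) {i : ℕ}
    (hi : i < n) :
    IsHereditySet (S ∪ pathsThrough {v | Ideal.Quotient.mk J.asIdeal (vertex K v) ∈ L i})
      {v | Ideal.Quotient.mk J.asIdeal (vertex K v) ∈ L (i + 1)} := by
  have h := isHereditySet_of_isHeredityIdeal (quotientMap_surjective (L i))
    (fun x => quotientMap_eq_zero_iff.trans (hL.mk_mem_iff hker hm hi.le x)) (m := m)
    (fun p hp => by
      rw [quotientMap_eq_zero_iff, hm p hp]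
      exact zero_mem _) (hL.heredity i hi)
  simpa only [quotientMap_mem_map_iff (hL.le_succ i hi)] using h

/-- A vertex chain that is a heredity chain of a monomial algebra satisfies the combinatorial
condition of `isHeredityChain_vertexChain`. -/
theorem isHereditySet_of_isHeredityChain_vertexChain
    (hker : ∀ x, Ideal.Quotient.mk J.asIdeal x = 0 ↔ x ∈ pathSpan K S) {m : ℕ}
    (hm : ∀ p : QuiverPath V, m ≤ p.2.2.length → Ideal.Quotient.mk J.asIdeal (ofPath K p) = 0)
    {σ : Fin (Fintype.card V) ≃ V} (hσ : IsHeredityChain (Fintype.card V) (vertexChain J σ))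
    (i : Fin (Fintype.card V)) :
    IsHereditySet (S ∪ pathsThrough (firstVertices σ i)) {σ i} := by
  have h := hσ.isHereditySet hker hm i.2
  have hS : S ∪ pathsThrough {v | Ideal.Quotient.mk J.asIdeal (vertex K v) ∈ vertexChain J σ i} =
      S ∪ pathsThrough (firstVertices σ i) := by
    refine pathSpan_injective (K := K) (Submodule.ext fun x => ?_)
    rw [← hσ.mk_mem_iff hker hm i.2.le, vertexChain_eq_vertexIdeal,
      map_mem_vertexIdeal_iff_of_ker Ideal.Quotient.mk_surjective hker]
  rw [hS] at h
  refine h.singleton subset_rfl ?_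
  rw [Set.mem_ofPred_eq, vertexChain_eq_vertexIdeal, firstVertices_succ]
  exact map_vertex_mem_vertexIdeal _ (Or.inr rfl)

/-- A heredity chain of a monomial algebra can be refined to one that adds a single vertex in each
step: order the vertices by the first term of the chain that contains them. -/
theorem IsHeredityChain.exists_isHereditySet
    (hker : ∀ x, Ideal.Quotient.mk J.asIdeal x = 0 ↔ x ∈ pathSpan K S) (hS : IsPathIdeal S) {m : ℕ}
    (hm : ∀ p : QuiverPath V, m ≤ p.2.2.length → Ideal.Quotient.mk J.asIdeal (ofPath K p) = 0)
    {n : ℕ} {L : ℕ → TwoSidedIdeal (QuiverAlgebra J)} (hL : IsHeredityChain n L) :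
    ∃ σ : Fin (Fintype.card V) ≃ V,
      ∀ i : Fin (Fintype.card V), IsHereditySet (S ∪ pathsThrough (firstVertices σ i)) {σ i} := by
  classical
  have hex : ∀ v : V, ∃ i, Ideal.Quotient.mk J.asIdeal (vertex K v) ∈ L i := fun v =>
    ⟨n, by rw [hL.last]; trivial⟩
  let level : V → ℕ := fun v => Nat.find (hex v)
  have hlevel : ∀ v, Ideal.Quotient.mk J.asIdeal (vertex K v) ∈ L (level v) := fun v =>
    Nat.find_spec (hex v)
  let e : Fin (Fintype.card V) ≃ V := (Fintype.equivFin V).symm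
  let σ : Fin (Fintype.card V) ≃ V := (Tuple.sort (level ∘ e)).trans e
  have hmono : Monotone fun i => level (σ i) := Tuple.monotone_sort (level ∘ e)
  refine ⟨σ, fun i => ?_⟩
  -- at level `0` the vertex already vanishes, so that all paths through it lie in `S`
  rcases Nat.eq_zero_or_pos (level (σ i)) with h0 | hpos
  · have h1 := hlevel (σ i)
    rw [h0, hL.zero, TwoSidedIdeal.mem_bot, hker] at h1
    have h2 : ∀ {b : V} (p : Quiver.Path (σ i) b), (⟨σ i, b, p⟩ : QuiverPath V) ∈ S := by
      intro b p
      have := hS.comp_right p (ofPath_mem_pathSpan_iff.1 h1)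
      rwa [Quiver.Path.nil_comp] at this
    constructor
    · rintro a b rfl rfl p -
      exact Or.inl (h2 p)
    · rintro a b c rfl p q - hq
      exact absurd (Or.inl (h2 q)) hq
  · obtain ⟨k, hk⟩ := Nat.exists_eq_succ_of_ne_zero hpos.ne'
    have hkn : k < n := by
      have h : level (σ i) ≤ n := Nat.find_min' (hex (σ i)) (by rw [hL.last]; trivial)
      omega
    refine (hL.isHereditySet hker hm hkn).singleton (fun u hu => ?_) ?_
    · have h1 : level u ≤ k := Nat.find_min' (hex u) hu
      by_contra h2
      have h3 := hmono (not_lt.1 h2 : i ≤ σ.symm u)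
      simp only [Equiv.apply_symm_apply] at h3
      omega
    · have := hlevel (σ i)
      rwa [hk] at this

end Chains

/-! ### Admissible ideals and their monomial ideals -/

section Admissible

variable {K : Type u} {V : Type v} [Quiver.{w} V] [Field K] [Fintype V]

theorem ofPath_mem_arrowIdeal_pow (k : ℕ) {a b : V} (p : Quiver.Path a b) (hp : k ≤ p.length) :
    ofPath K ⟨a, b, p⟩ ∈ (arrowIdeal K V).asIdeal ^ k := by
  induction k generalizing b with
  | zero => rw [Submodule.pow_zero, Ideal.one_eq_top]; trivial
  | succ k ih =>
    cases p with
    | nil => exact absurd hp (Nat.not_succ_le_zero k)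
    | cons p e =>
      have h : ofPath K ⟨a, b, p.cons e⟩ = ofPath K ⟨a, _, p⟩ * ofPath K ⟨_, b, e.toPath⟩ := by
        rw [ofPath_mul_comp]
        rfl
      rw [h, Submodule.pow_succ]
      exact Ideal.mul_mem_mul (ih p (Nat.le_of_succ_le_succ hp))
        (TwoSidedIdeal.subset_span ⟨_, rfl, rfl⟩)

/-- The ideal generated by the tips of `I` is spanned by the reducible paths of `KQ/I`. -/
theorem mk_monomialIdeal_eq_zero_iff {r : QuiverPath V → QuiverPath V → Prop}
    (hr : IsAdmissibleOrder r) (I : TwoSidedIdeal (PathAlgebra K V)) (x : PathAlgebra K V) :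
    Ideal.Quotient.mk (monomialIdeal r I).asIdeal x = 0 ↔
      x ∈ pathSpan K (reduciblePaths r (Ideal.Quotient.mk I.asIdeal)) := by
  have h : {y | ∃ x ∈ I, ∃ p, IsTip r x p ∧ y = ofPath K p} =
      ofPath K '' reduciblePaths r (Ideal.Quotient.mk I.asIdeal) := by
    ext y
    simp only [Set.mem_ofPred_eq, Set.mem_image, mem_reduciblePaths_iff_exists_isTip hr,
      Ideal.Quotient.eq_zero_iff_mem, TwoSidedIdeal.mem_asIdeal]
    constructor
    · rintro ⟨x, hx, p, hp, rfl⟩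
      exact ⟨p, ⟨x, hx, hp⟩, rfl⟩
    · rintro ⟨p, ⟨x, hx, hp⟩, rfl⟩
      exact ⟨x, hx, p, hp, rfl⟩
  rw [Ideal.Quotient.eq_zero_iff_mem, TwoSidedIdeal.mem_asIdeal, monomialIdeal, h,
    span_ofPath_image (isPathIdeal_reduciblePaths hr _), mem_pathIdeal]

end Admissible

theorem theoremB {K : Type u} {V : Type v} [Field K] [Quiver.{w} V] [Fintype V]
    (r : QuiverPath V → QuiverPath V → Prop) (hr : IsAdmissibleOrder r)
    (I : TwoSidedIdeal (PathAlgebra K V)) (hI : IsAdmissibleIdeal I)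
    (hfin : FiniteDimensional K (QuiverAlgebra I))
    (hMon : IsQuasiHereditary (QuiverAlgebra (monomialIdeal r I))) :
    IsQuasiHereditary (QuiverAlgebra I) ∧
      (∃ σ : Fin (Fintype.card V) ≃ V,
        IsHeredityChain (Fintype.card V) (vertexChain (monomialIdeal r I) σ)) ∧
      ∀ σ : Fin (Fintype.card V) ≃ V,
        IsHeredityChain (Fintype.card V) (vertexChain (monomialIdeal r I) σ) →
          IsHeredityChain (Fintype.card V) (vertexChain I σ) := by
  obtain ⟨m, -, hm⟩ := hI.1
  have hI0 : ∀ p : QuiverPath V, m ≤ p.2.2.length →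
      Ideal.Quotient.mk I.asIdeal (ofPath K p) = 0 := fun p hp =>
    Ideal.Quotient.eq_zero_iff_mem.2 (hm (ofPath_mem_arrowIdeal_pow m p.2.2 hp))
  have hker := mk_monomialIdeal_eq_zero_iff hr I
  have hM0 : ∀ p : QuiverPath V, m ≤ p.2.2.length →
      Ideal.Quotient.mk (monomialIdeal r I).asIdeal (ofPath K p) = 0 := fun p hp =>
    (hker _).2 (ofPath_mem_pathSpan ⟨0, zero_mem _, by rw [hI0 p hp, map_zero]⟩)
  have hred := reduciblePaths_eq_of_ker hr hker
  have hall : ∀ σ : Fin (Fintype.card V) ≃ V,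
      IsHeredityChain (Fintype.card V) (vertexChain (monomialIdeal r I) σ) →
        IsHeredityChain (Fintype.card V) (vertexChain I σ) := fun σ hσ =>
    isHeredityChain_vertexChain hr hI0
      (isHereditySet_of_isHeredityChain_vertexChain hker hM0 hσ)
  obtain ⟨n, L, hL⟩ := hMon
  obtain ⟨σ, hσ⟩ := hL.exists_isHereditySet hker (isPathIdeal_reduciblePaths hr _) hM0
  have hσM : IsHeredityChain (Fintype.card V) (vertexChain (monomialIdeal r I) σ) :=
    isHeredityChain_vertexChain hr hM0 (by rwa [hred])
  exact ⟨⟨_, _, hall σ hσM⟩, ⟨σ, hσM⟩, hall⟩
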